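/- **Setting.** Let $\mathfrak{Comp}$ be the category of compact metric spaces with isometric embeddings as morphisms. Let $\mathfrak{Pos}$ be the category of posets with order-preserving maps, and let $\mathfrak{Pos_m}$ be the category of extended metric spaces $A$ (distance $\infty$ allowed) with a partial order such that $\{a'\in A: a'\le a\}$ is compact for every $a\in A$, with order-preserving isometric embeddings as morphisms. Let $\tau:\mathfrak{Comp}\to\mathfrak{Pos_m}$ be a functor, $f\mapsto \tau_f$, such that for every isometry $f:X\to X$ of a compact metric space onto itself and every $a\in\tau(X)$, $\tau_f(a)\le a$ implies $\tau_f(a)=a$. Let $\tau^t$ be a contravariant functor from $\mathfrak{Comp}$ to $\mathfrak{Pos}$ (truncation) with $\tau^t(X)=\tau(X)$ as posets and, for every morphism $f:X\to Y$, $a\in\tau(X)$, $b\in\tau(Y)$, $$\tau^t_f(\tau_f(a))=a,\qquad \tau_f(\tau^t_f(b))\le b .$$ A metric space is *boundedly compact* if its closed balls are compact. For such $X$ let $\varphi(X)$ be the set of families $(a_Y)_Y$, indexed by the compact subsets $Y\subseteq X$, with $a_Y\in\tau(Y)$ and $\tau^t_\iota(a_{Y'})=a_Y$ whenever $Y\subseteq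 Y'$ with inclusion $\iota$. Let $\mathcal C'$ be the set of isomorphism classes of tuples $\mathcal X=(X,o;a)$, where $X$ is boundedly compact, $o\in X$ and $a\in\varphi(X)$; an isomorphism $(X,o;a)\to(X',o';a')$ is an isometry $e$ of $X$ onto $X'$ with $e(o)=o'$ and $\tau_{e|_Y}(a_Y)=a'_{e(Y)}$ for every compact $Y\subseteq X$, where $e|_Y:Y\to e(Y)$. Let $\mathcal C$ be the set of isomorphism classes of triples $(X,o;a)$ with $X$ compact, $o\in X$, $a\in\tau(X)$ (isomorphisms: isometries $e$ of $X$ onto $X'$ with $e(o)=o'$, $\tau_e(a)=a'$). A triple in $\mathcal C$ is identified with the tuple whose family consists of the truncations of $a$. With $\tau'(X):=X\times\tau(X)$ (max product metric), let $$d^c_{\tau'}\big((X,o;a),(Y,p;b)\big):=\inf_{Z,f,g}\ d_H(f(X),g(Y))\vee d(f(o),g(p))\vee d(\tau_f(a),\tau_g(b)),$$ the infimum being over all compact metric spaces $Z$ and all isometric embeddings $f:X\to Z$, $g:Y\to Z$; here $d_H$ is the Hausdorff distance. For a tuple $\mathcal X=(X,o;a)$ and $r\ge0$, let $\mathcal X^{(r)}:=(B_r,o;a_{B_r})$,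 where $B_r$ is the closed ball of radius $r$ centered at $o$. For $S'\subseteq S$ compact subsets of $X$ containing $o$, write $(S',o;a')\preceq(S,o;a'')$ if $a'\le\tau^t_\iota(a'')$, where $\iota:S'\hookrightarrow S$; write $(S',o;a')\preceq\mathcal X$ if $a'\le a_{S'}$. For $0<\epsilon\le1$ let $$a_\epsilon(\mathcal X,\mathcal Y):=\inf\{d^c_{\tau'}(\mathcal X^{(1/\epsilon)},\mathcal Y'):\ \mathcal Y'\text{ compact},\ \mathcal Y^{(1/\epsilon-\epsilon)}\preceq\mathcal Y'\preceq\mathcal Y\},$$ $$d(\mathcal X,\mathcal Y):=\inf\{\epsilon\in(0,1]:\ a_\epsilon(\mathcal X,\mathcal Y)\vee a_\epsilon(\mathcal Y,\mathcal X)<\epsilon/2\},\qquad \inf\emptyset:=1 .$$ **Assumptions.** 1. $\tau$ is pointwise-continuous: if $f,f_1,f_2,\ldots$ are isometric embeddings of a compact metric space $X$ into a compact metric space $Y$ and $f_n\to f$ pointwise, then $\tau_{f_n}\to\tau_f$ pointwise. 2. For all compact tuples $\mathcal X,\mathcal Y$ and every compact $\mathcal X'\preceq\mathcal X$ there exists a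 compact $\mathcal Y'\preceq\mathcal Y$ with $d^c_{\tau'}(\mathcal X',\mathcal Y')\le d^c_{\tau'}(\mathcal X,\mathcal Y)$. 3. In 2, if $\epsilon:=d^c_{\tau'}(\mathcal X,\mathcal Y)<\infty$, $r\ge2\epsilon$ and $\mathcal X^{(r)}\preceq\mathcal X'\preceq\mathcal X$, then $\mathcal Y'$ can be chosen such that also $\mathcal Y^{(r-2\epsilon)}\preceq\mathcal Y'\preceq\mathcal Y$. 4. If $Z,X,X_1,X_2,\ldots$ are compact metric spaces and $f:X\to Z$, $f_n:X_n\to Z$ are isometric embeddings with $d_H(f_n(X_n),f(X))\to0$, and if $b\in\tau(Z)$ and $a_n\in\tau(X_n)$ satisfy $\tau_{f_n}(a_n)\to b$, then $b\in\tau_f(\tau(X))$. **Theorem.** Under these assumptions, a subset $\mathcal A\subseteq\mathcal C'$ is relatively compact (its closure is compact) under $d$ if and only if for every $r\ge0$ the set $\mathcal A_r$ of the classes of the balls $\mathcal X^{(r)}$, $\mathcal X\in\mathcal A$, is relatively compact in $\mathcal C$ under $d^c_{\tau'}$. -/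

import Mathlib

open Set Filter Topology TopologicalSpace
open scoped NNReal ENNReal

universe u v

/-! ### Relative compactness with respect to a distance function -/

/-- The topology of a distance function `d`: a set is open if it contains a `d`-ball around each of
its points. When `d` is an (extended) metric, this is the metric topology. -/
@[reducible]
def distTopology {α : Type u} (d : α → α → ℝ≥0∞) : TopologicalSpace α where
  IsOpen s := ∀ x ∈ s, ∃ ε : ℝ≥0∞, 0 < ε ∧ ∀ y, d x y < ε → y ∈ s
  isOpen_univ := fun _ _ => ⟨1, one_pos, fun _ _ => mem_univ _⟩
  isOpen_inter := by
    rintro s t hs ht x ⟨hxs, hxt⟩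
    obtain ⟨ε, hε, h⟩ := hs x hxs
    obtain ⟨δ, hδ, h'⟩ := ht x hxt
    exact ⟨min ε δ, lt_min hε hδ, fun y hy =>
      ⟨h y (hy.trans_le (min_le_left _ _)), h' y (hy.trans_le (min_le_right _ _))⟩⟩
  isOpen_sUnion := by
    rintro S hS x ⟨s, hs, hx⟩
    obtain ⟨ε, hε, h⟩ := hS s hs x hx
    exact ⟨ε, hε, fun y hy => ⟨s, hs, h y hy⟩⟩

/-- `A` is relatively compact under `d`: its closure is compact. -/
def IsRelCompactDist {α : Type u} (d : α → α → ℝ≥0∞) (A : Set α) : Prop :=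
  @IsCompact α (distTopology d) (@closure α (distTopology d) A)

/-! ### Compact metric spaces and isometric embeddings -/

/-- A compact metric space (possibly empty). -/
structure CompMet : Type (u + 1) where
  carrier : Type u
  [metric : MetricSpace carrier]
  [compact : CompactSpace carrier]

namespace CompMet

instance : CoeSort CompMet.{u} (Type u) := ⟨CompMet.carrier⟩

instance (X : CompMet.{u}) : MetricSpace X := X.metric

instance (X : CompMet.{u}) : CompactSpace X := X.compact

/-- The morphisms of compact metric spaces: isometric embeddings. -/
structure Hom (X Y : CompMet.{u}) where
  toFun : X → Y
  isometry : Isometry toFun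

namespace Hom

instance (X Y : CompMet.{u}) : CoeFun (Hom X Y) (fun _ => X → Y) := ⟨Hom.toFun⟩

@[ext]
theorem ext {X Y : CompMet.{u}} {f g : Hom X Y} (h : ∀ x, f x = g x) : f = g := by
  cases f; cases g; congr; exact funext h

/-- The identity morphism. -/
def id (X : CompMet.{u}) : Hom X X := ⟨fun x => x, isometry_id⟩

/-- Composition of isometric embeddings. -/
def comp {X Y Z : CompMet.{u}} (g : Hom Y Z) (f : Hom X Y) : Hom X Z :=
  ⟨fun x => g (f x), g.isometry.comp f.isometry⟩

/-- An isometry, seen as a morphism. -/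
def ofEquiv {X Y : CompMet.{u}} (e : X ≃ᵢ Y) : Hom X Y := ⟨e, e.isometry⟩

end Hom

/-- A compact subset `S` of a metric space, as a compact metric space. -/
def ofSet {X : Type u} [MetricSpace X] (S : Compacts X) : CompMet.{u} where
  carrier := {x : X // x ∈ S}
  compact := isCompact_iff_compactSpace.mp S.isCompact

/-- The inclusion map between two compact subsets. -/
def incl {X : Type u} [MetricSpace X] {S T : Compacts X} (h : S ≤ T) :
    Hom (ofSet S) (ofSet T) :=
  ⟨fun x => ⟨x.1, h x.2⟩, fun _ _ => rfl⟩

/-- The inclusion map of a compact subset of a compact metric space. -/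
def inclSpace {X : CompMet.{u}} (S : Compacts X) : Hom (ofSet S) X :=
  ⟨fun x => x.1, fun _ _ => rfl⟩

/-- The restriction `S → T` of an isometry `e : X → Y`, where `S` is the preimage of `T`. It is
itself an isometry. -/
def restrict {X Y : Type u} [MetricSpace X] [MetricSpace Y] (e : X ≃ᵢ Y)
    {S : Compacts X} {T : Compacts Y} (h : ∀ x, e x ∈ T ↔ x ∈ S) : ofSet S ≃ᵢ ofSet T where
  toEquiv := e.toEquiv.subtypeEquiv fun x => (h x).symm
  isometry_toFun := fun x y => e.isometry x.1 y.1

end CompMet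

/-! ### Functors to (extended) metric spaces, and the Gromov-Hausdorff-functor distance -/

/-- A functor from compact metric spaces to extended metric spaces; morphisms are isometric
embeddings on both sides. -/
structure MetFunctor where
  obj : CompMet.{u} → Type v
  [emetric : ∀ X, EMetricSpace (obj X)]
  map : ∀ {X Y : CompMet.{u}}, X.Hom Y → obj X → obj Y
  isometry_map : ∀ {X Y : CompMet.{u}} (f : X.Hom Y), Isometry (map f)
  map_id : ∀ (X : CompMet.{u}) (a : obj X), map (CompMet.Hom.id X) a = a
  map_comp : ∀ {X Y Z : CompMet.{u}} (g : Y.Hom Z) (f : X.Hom Y) (a : obj X),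
    map (g.comp f) a = map g (map f a)

namespace MetFunctor

instance (F : MetFunctor.{u, v}) (X : CompMet.{u}) : EMetricSpace (F.obj X) := F.emetric X

/-- If `f_n → f` pointwise, then `τ_{f_n} → τ_f` pointwise. -/
def PointwiseContinuous (F : MetFunctor.{u, v}) : Prop :=
  ∀ (X Y : CompMet.{u}) (f : X.Hom Y) (fs : ℕ → X.Hom Y),
    (∀ x, Tendsto (fun n => fs n x) atTop (𝓝 (f x))) →
    ∀ a : F.obj X, Tendsto (fun n => F.map (fs n) a) atTop (𝓝 (F.map f a))

/-- If `Im f_n → Im f` in the Hausdorff distance and `τ_{f_n}(a_n) → b`, then `b ∈ Im τ_f`. -/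
def HausdorffClosed (F : MetFunctor.{u, v}) : Prop :=
  ∀ (Z X : CompMet.{u}) (Xs : ℕ → CompMet.{u}) (f : X.Hom Z) (fs : ∀ n, (Xs n).Hom Z),
    Tendsto (fun n => Metric.hausdorffEDist (range (fs n)) (range f)) atTop (𝓝 0) →
    ∀ (b : F.obj Z) (a : ∀ n, F.obj (Xs n)),
      Tendsto (fun n => F.map (fs n) (a n)) atTop (𝓝 b) → b ∈ range (F.map f)

/-- A pair `(X, a)` with `X` a compact metric space and `a ∈ τ(X)`. -/
structure Pair (F : MetFunctor.{u, v}) where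
  space : CompMet.{u}
  pt : F.obj space

namespace Pair

variable {F : MetFunctor.{u, v}}

/-- Pairs are isomorphic if an isometry `e` satisfies `τ_e(a) = b`. -/
def Iso (P Q : F.Pair) : Prop :=
  ∃ e : P.space ≃ᵢ Q.space, F.map (CompMet.Hom.ofEquiv e) P.pt = Q.pt

theorem Iso.refl (P : F.Pair) : Iso P P := ⟨IsometryEquiv.refl _, F.map_id _ _⟩

theorem Iso.symm {P Q : F.Pair} : Iso P Q → Iso Q P := by
  rintro ⟨e, he⟩
  refine ⟨e.symm, ?_⟩
  rw [← he, ← F.map_comp]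
  convert F.map_id P.space P.pt using 2
  ext x
  exact e.symm_apply_apply x

theorem Iso.trans {P Q R : F.Pair} : Iso P Q → Iso Q R → Iso P R := by
  rintro ⟨e, he⟩ ⟨e', he'⟩
  refine ⟨e.trans e', ?_⟩
  rw [← he', ← he, ← F.map_comp]
  rfl

instance setoid (F : MetFunctor.{u, v}) : Setoid F.Pair :=
  ⟨Iso, Iso.refl, Iso.symm, Iso.trans⟩

/-- The Gromov-Hausdorff-functor distance of two pairs: the infimum over all compact metric
spaces `Z` and all isometric embeddings of both spaces into `Z`. -/
noncomputable def ghf (P Q : F.Pair) : ℝ≥0∞ :=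
  ⨅ (Z : CompMet.{u}) (f : P.space.Hom Z) (g : Q.space.Hom Z),
    max (Metric.hausdorffEDist (range f) (range g)) (edist (F.map f P.pt) (F.map g Q.pt))

theorem ghf_comm (P Q : F.Pair) : ghf P Q = ghf Q P := by
  unfold ghf
  refine iInf_congr fun Z => ?_
  rw [iInf_comm]
  simp only [Metric.hausdorffEDist_comm, edist_comm]

theorem ghf_le_of_iso {P P' Q : F.Pair} (h : Iso P P') : ghf P Q ≤ ghf P' Q := by
  obtain ⟨e, he⟩ := h
  refine le_iInf fun Z => le_iInf fun f => le_iInf fun g => ?_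
  refine iInf_le_of_le Z (iInf_le_of_le (f.comp (CompMet.Hom.ofEquiv e)) (iInf_le_of_le g ?_))
  rw [F.map_comp, he]
  have : range (f.comp (CompMet.Hom.ofEquiv e)) = range f := e.surjective.range_comp f
  rw [this]

theorem ghf_congr {P P' Q Q' : F.Pair} (h : Iso P P') (h' : Iso Q Q') :
    ghf P Q = ghf P' Q' := by
  have key : ∀ {P P' Q : F.Pair}, Iso P P' → ghf P Q = ghf P' Q := fun h =>
    le_antisymm (ghf_le_of_iso h) (ghf_le_of_iso h.symm)
  rw [key h, ghf_comm, key h', ghf_comm]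

end Pair

/-- The set `𝒞_τ` of isomorphism classes of pairs. -/
def Classes (F : MetFunctor.{u, v}) := Quotient (Pair.setoid F)

/-- The Gromov-Hausdorff-functor distance `d^c_τ` on `𝒞_τ`. -/
noncomputable def Classes.ghf {F : MetFunctor.{u, v}} : F.Classes → F.Classes → ℝ≥0∞ :=
  Quotient.lift₂ Pair.ghf fun _ _ _ _ h h' => Pair.ghf_congr h h'

/-- The functor `τ'(X) = X × τ(X)`, with the max product metric. -/
def pointed (F : MetFunctor.{u, v}) : MetFunctor.{u, max u v} where
  obj X := X × F.obj X
  map f p := (f p.1, F.map f p.2)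
  isometry_map f := f.isometry.prodMap (F.isometry_map f)
  map_id X a := Prod.ext rfl (F.map_id X a.2)
  map_comp g f a := Prod.ext rfl (F.map_comp g f a.2)

end MetFunctor

/-! ### Functors to ordered extended metric spaces, and truncation functors -/

/-- A functor from compact metric spaces to extended metric spaces with a partial order whose cones
`{a' | a' ≤ a}` are compact; the morphisms between the latter are the order-preserving isometric
embeddings. -/
structure PosMetFunctor extends MetFunctor.{u, v} where
  [order : ∀ X, PartialOrder (obj X)]
  isCompact_cone : ∀ (X : CompMet.{u}) (a : obj X), IsCompact {a' : obj X | a' ≤ a}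
  monotone_map : ∀ {X Y : CompMet.{u}} (f : X.Hom Y), Monotone (map f)

namespace PosMetFunctor

instance (τ : PosMetFunctor.{u, v}) (X : CompMet.{u}) : PartialOrder (τ.obj X) := τ.order X

/-- For every isometry `e : X → X` and `a ∈ τ(X)`, if `τ_e(a) ≤ a` then `τ_e(a) = a`. -/
def Rigid (τ : PosMetFunctor.{u, v}) : Prop :=
  ∀ (X : CompMet.{u}) (e : X ≃ᵢ X) (a : τ.obj X),
    τ.map (CompMet.Hom.ofEquiv e) a ≤ a → τ.map (CompMet.Hom.ofEquiv e) a = a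

/-- A truncation functor for `τ`: a contravariant functor to posets with the same objects as `τ`
such that `τᵗ_f (τ_f a) = a` and `τ_f (τᵗ_f b) ≤ b`. -/
structure Truncation (τ : PosMetFunctor.{u, v}) where
  tmap : ∀ {X Y : CompMet.{u}}, X.Hom Y → τ.obj Y → τ.obj X
  monotone_tmap : ∀ {X Y : CompMet.{u}} (f : X.Hom Y), Monotone (tmap f)
  tmap_id : ∀ (X : CompMet.{u}) (a : τ.obj X), tmap (CompMet.Hom.id X) a = a
  tmap_comp : ∀ {X Y Z : CompMet.{u}} (g : Y.Hom Z) (f : X.Hom Y) (c : τ.obj Z),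
    tmap (g.comp f) c = tmap f (tmap g c)
  tmap_map : ∀ {X Y : CompMet.{u}} (f : X.Hom Y) (a : τ.obj X), tmap f (τ.map f a) = a
  map_tmap_le : ∀ {X Y : CompMet.{u}} (f : X.Hom Y) (b : τ.obj Y), τ.map f (tmap f b) ≤ b

end PosMetFunctor

namespace PosMetFunctor.Truncation

variable {τ : PosMetFunctor.{u, v}}

/-- The extension `φ(X)` of `τ` to boundedly-compact spaces: families `a_Y ∈ τ(Y)`, indexed by the
compact subsets `Y` of `X`, which are compatible under truncation. -/
structure Ext (t : τ.Truncation) (X : Type u) [MetricSpace X] where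
  val : ∀ Y : Compacts X, τ.obj (CompMet.ofSet Y)
  compat : ∀ {Y Y' : Compacts X} (h : Y ≤ Y'), t.tmap (CompMet.incl h) (val Y') = val Y

/-- A tuple `(X, o; a)` with `X` a boundedly-compact metric space, `o ∈ X` and `a ∈ φ(X)`. -/
structure Tuple (t : τ.Truncation) where
  space : Type u
  [metric : MetricSpace space]
  [proper : ProperSpace space]
  o : space
  a : t.Ext space

namespace Tuple

variable {t : τ.Truncation}

instance (X : t.Tuple) : MetricSpace X.space := X.metric

instance (X : t.Tuple) : ProperSpace X.space := X.proper

/-- Tuples are isomorphic if there is an isometry `e` preserving the distinguished points such that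
`φ_e(a) = a'`, that is, `a'_{Y'} = τ_g(a_Y)` for all compact sets `Y'`, where `Y = e⁻¹(Y')` and
`g : Y → Y'` is the restriction of `e`. -/
def Iso (X X' : t.Tuple) : Prop :=
  ∃ e : X.space ≃ᵢ X'.space, e X.o = X'.o ∧
    ∀ (Y : Compacts X.space) (Y' : Compacts X'.space) (h : ∀ x, e x ∈ Y' ↔ x ∈ Y),
      τ.map (CompMet.Hom.ofEquiv (CompMet.restrict e h)) (X.a.val Y) = X'.a.val Y'

/-- The image of a compact set under an isometry. -/
def imageSet {X Y : Type u} [MetricSpace X] [MetricSpace Y] (e : X ≃ᵢ Y) (S : Compacts X) :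
    Compacts Y :=
  S.map e e.continuous

theorem mem_imageSet {X Y : Type u} [MetricSpace X] [MetricSpace Y] (e : X ≃ᵢ Y)
    (S : Compacts X) (x : X) : e x ∈ imageSet e S ↔ x ∈ S := by
  change e x ∈ e '' (S : Set X) ↔ _
  simp

theorem Iso.refl (X : t.Tuple) : Iso X X := by
  refine ⟨IsometryEquiv.refl _, rfl, fun Y Y' h => ?_⟩
  obtain rfl : Y = Y' := by
    ext x
    exact (h x).symm
  exact τ.map_id _ _

theorem Iso.symm {X X' : t.Tuple} : Iso X X' → Iso X' X := by
  rintro ⟨e, ho, he⟩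
  refine ⟨e.symm, by rw [← ho, e.symm_apply_apply], fun Y' Y h => ?_⟩
  have h' : ∀ x, e x ∈ Y' ↔ x ∈ Y := fun x => by rw [← h, e.symm_apply_apply]
  rw [← he Y Y' h', ← τ.map_comp]
  convert τ.map_id _ (X.a.val Y) using 2
  ext x
  exact Subtype.ext (e.symm_apply_apply x.1)

theorem Iso.trans {X Y Z : t.Tuple} : Iso X Y → Iso Y Z → Iso X Z := by
  rintro ⟨e, ho, he⟩ ⟨e', ho', he'⟩
  refine ⟨e.trans e', by rw [← ho', ← ho]; rfl, fun S T h => ?_⟩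
  have h1 := mem_imageSet e S
  have h2 : ∀ y, e' y ∈ T ↔ y ∈ imageSet e S := fun y => by
    obtain ⟨x, rfl⟩ := e.surjective y
    rw [h1, ← h]
    rfl
  rw [← he' _ _ h2, ← he _ _ h1, ← τ.map_comp]
  rfl

instance setoid (t : τ.Truncation) : Setoid t.Tuple := ⟨Iso, Iso.refl, Iso.symm, Iso.trans⟩

/-- The tuples `𝒳' ⪯ 𝒳` with compact underlying space: a compact subset of `X` containing `o`,
together with an element `a'` of `τ` of this subset which is at most the truncation of `a`. -/
structure Sub (X : t.Tuple) where
  carrier : Compacts X.space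
  o_mem : X.o ∈ carrier
  a : τ.obj (CompMet.ofSet carrier)
  a_le : a ≤ X.a.val carrier

/-- The relation `⪯` between tuples `⪯ 𝒳`. -/
instance (X : t.Tuple) : LE X.Sub where
  le P Q := ∃ h : P.carrier ≤ Q.carrier, P.a ≤ t.tmap (CompMet.incl h) Q.a

/-- A compact tuple `𝒳' ⪯ 𝒳`, as a pair for the functor `τ'`. -/
def Sub.toPair {X : t.Tuple} (P : X.Sub) : τ.pointed.Pair where
  space := CompMet.ofSet P.carrier
  pt := (⟨X.o, P.o_mem⟩, P.a)

/-- The truncated ball `𝒳^(r)`: the closed ball of radius `r` centered at `o` with the truncation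
of `a` to it. -/
def ball (X : t.Tuple) (r : ℝ≥0) : X.Sub where
  carrier := ⟨Metric.closedBall X.o r, isCompact_closedBall X.o r⟩
  o_mem := Metric.mem_closedBall_self r.2
  a := X.a.val _
  a_le := le_rfl

/-- The quantity `a_ε(𝒳, 𝒴)`: the infimum of `d^c(𝒳^(1/ε), 𝒴')` over all compact `𝒴'` such that
`𝒴^(1/ε-ε) ⪯ 𝒴' ⪯ 𝒴`. It is used for `0 < ε ≤ 1` only, where `1/ε-ε ≥ 0`. -/
noncomputable def approx (ε : ℝ≥0) (X Y : t.Tuple) : ℝ≥0∞ :=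
  ⨅ (Y' : Y.Sub) (_ : Y.ball (1 / ε - ε) ≤ Y'), (X.ball (1 / ε)).toPair.ghf Y'.toPair

/-- The distance of two tuples: the infimum of the `ε ∈ (0, 1]` such that
`a_ε(𝒳, 𝒴) ∨ a_ε(𝒴, 𝒳) < ε / 2`. Inserting `1` realizes the convention `inf ∅ = 1` and changes
nothing otherwise. -/
noncomputable def distance (X Y : t.Tuple) : ℝ≥0 :=
  sInf (insert 1 {ε : ℝ≥0 | 0 < ε ∧ ε ≤ 1 ∧
    max (approx ε X Y) (approx ε Y X) < (ε : ℝ≥0∞) / 2})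

theorem ball_iso {X X' : t.Tuple} (h : Iso X X') (r : ℝ≥0) :
    (X.ball r).toPair.Iso (X'.ball r).toPair := by
  obtain ⟨e, ho, he⟩ := h
  have hb : ∀ x, e x ∈ (X'.ball r).carrier ↔ x ∈ (X.ball r).carrier := fun x => by
    change e x ∈ Metric.closedBall X'.o r ↔ x ∈ Metric.closedBall X.o r
    rw [← ho, Metric.mem_closedBall, Metric.mem_closedBall, e.dist_eq]
  exact ⟨CompMet.restrict e hb, Prod.ext (Subtype.ext ho) (he _ _ hb)⟩

theorem exists_sub_iso {X X' : t.Tuple} (h : Iso X X') (r : ℝ≥0) (P : X.Sub)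
    (hP : X.ball r ≤ P) : ∃ P' : X'.Sub, X'.ball r ≤ P' ∧ P.toPair.Iso P'.toPair := by
  obtain ⟨e, ho, he⟩ := h
  have hm := mem_imageSet e P.carrier
  have hb : ∀ x, e x ∈ (X'.ball r).carrier ↔ x ∈ (X.ball r).carrier := fun x => by
    change e x ∈ Metric.closedBall X'.o r ↔ x ∈ Metric.closedBall X.o r
    rw [← ho, Metric.mem_closedBall, Metric.mem_closedBall, e.dist_eq]
  refine ⟨⟨imageSet e P.carrier, by rw [← ho, hm]; exact P.o_mem,
    τ.map (CompMet.Hom.ofEquiv (CompMet.restrict e hm)) P.a, ?_⟩, ?_, ?_⟩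
  · rw [← he _ _ hm]
    exact τ.monotone_map _ P.a_le
  · obtain ⟨hsub, hle⟩ := hP
    have hsub' : (X'.ball r).carrier ≤ imageSet e P.carrier := fun y hy => by
      obtain ⟨x, rfl⟩ := e.surjective y
      exact (hm x).2 (hsub ((hb x).1 hy))
    refine ⟨hsub', ?_⟩
    have hball : (X'.ball r).a =
        τ.map (CompMet.Hom.ofEquiv (CompMet.restrict e hb)) (X.ball r).a := (he _ _ hb).symm
    rw [hball, ← t.tmap_map (CompMet.incl hsub')
      (τ.map (CompMet.Hom.ofEquiv (CompMet.restrict e hb)) (X.ball r).a)]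
    refine t.monotone_tmap _ ?_
    have key : τ.map (CompMet.incl hsub')
          (τ.map (CompMet.Hom.ofEquiv (CompMet.restrict e hb)) (X.ball r).a) =
        τ.map (CompMet.Hom.ofEquiv (CompMet.restrict e hm))
          (τ.map (CompMet.incl hsub) (X.ball r).a) := by
      rw [← τ.map_comp, ← τ.map_comp]
      rfl
    refine key.trans_le (τ.monotone_map _ ?_)
    exact (τ.monotone_map _ hle).trans (t.map_tmap_le _ _)
  · exact ⟨CompMet.restrict e hm, Prod.ext (Subtype.ext ho) rfl⟩

theorem approx_congr {X X' Y Y' : t.Tuple} (hX : Iso X X') (hY : Iso Y Y') (ε : ℝ≥0) :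
    approx ε X Y = approx ε X' Y' := by
  have key : ∀ {X X' Y Y' : t.Tuple}, Iso X X' → Iso Y Y' → approx ε X Y ≤ approx ε X' Y' := by
    intro X X' Y Y' hX hY
    refine le_iInf fun Q' => le_iInf fun hQ' => ?_
    obtain ⟨Q, hQ, hi⟩ := exists_sub_iso hY.symm _ Q' hQ'
    refine iInf_le_of_le Q (iInf_le_of_le hQ ?_)
    exact (MetFunctor.Pair.ghf_congr (ball_iso hX _) hi.symm).le
  exact le_antisymm (key hX hY) (key hX.symm hY.symm)

/-- The tuple `(X, o; a)` of a compact space `X` and `a ∈ τ(X)`; the corresponding element of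
`φ(X)` consists of all the truncations of `a`. -/
def ofPair (t : τ.Truncation) (P : τ.pointed.Pair) : t.Tuple where
  space := P.space
  o := P.pt.1
  a :=
    { val := fun Y => t.tmap (CompMet.inclSpace Y) P.pt.2
      compat := fun _ => (t.tmap_comp _ _ _).symm }

end Tuple

/-- The set `𝒞'` of isomorphism classes of tuples `(X, o; a)`. -/
def Classes (t : τ.Truncation) := Quotient (Tuple.setoid t)

/-- The class of a tuple. -/
def Tuple.toClass {t : τ.Truncation} (X : t.Tuple) : t.Classes := Quotient.mk _ X

/-- The class in `𝒞 = 𝒞_τ'` of a compact tuple `𝒳' ⪯ 𝒳`. -/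
def Tuple.Sub.toClass {t : τ.Truncation} {X : t.Tuple} (P : X.Sub) : τ.pointed.Classes :=
  Quotient.mk _ P.toPair

/-- The metric of `𝒞'`. -/
noncomputable def Classes.distance {t : τ.Truncation} : t.Classes → t.Classes → ℝ≥0 :=
  Quotient.lift₂ Tuple.distance fun _ _ _ _ hX hY => by
    unfold Tuple.distance
    simp only [Tuple.approx_congr hX hY, Tuple.approx_congr hY hX]

/-- For a set `𝒜 ⊆ 𝒞'`, the set `𝒜_r` of the classes of the truncated balls `𝒳^(r)`, `𝒳 ∈ 𝒜`. -/
def ballClasses {t : τ.Truncation} (A : Set t.Classes) (r : ℝ≥0) : Set τ.pointed.Classes :=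
  {c | ∃ X : t.Tuple, X.toClass ∈ A ∧ (X.ball r).toClass = c}

/-- For all compact tuples `𝒳`, `𝒴` and every `𝒳' ⪯ 𝒳` there exists `𝒴' ⪯ 𝒴` such that
`d^c(𝒳', 𝒴') ≤ d^c(𝒳, 𝒴)`. -/
def SubtupleApprox (t : τ.Truncation) : Prop :=
  ∀ (P Q : τ.pointed.Pair) (P' : (Tuple.ofPair t P).Sub),
    ∃ Q' : (Tuple.ofPair t Q).Sub, P'.toPair.ghf Q'.toPair ≤ P.ghf Q

/-- In the previous property, if `𝒳^(r) ⪯ 𝒳' ⪯ 𝒳` and `r ≥ 2 ε`, where `ε = d^c(𝒳, 𝒴)`, then `𝒴'`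
can be chosen such that also `𝒴^(r - 2 ε) ⪯ 𝒴' ⪯ 𝒴`. -/
def SubtupleApproxBall (t : τ.Truncation) : Prop :=
  ∀ (P Q : τ.pointed.Pair) (P' : (Tuple.ofPair t P).Sub) (ε r : ℝ≥0),
    P.ghf Q = ε → 2 * ε ≤ r → (Tuple.ofPair t P).ball r ≤ P' →
    ∃ Q' : (Tuple.ofPair t Q).Sub,
      (Tuple.ofPair t Q).ball (r - 2 * ε) ≤ Q' ∧ P'.toPair.ghf Q'.toPair ≤ P.ghf Q

end PosMetFunctor.Truncation

/-! Both distances are pseudo-metrics (`ghf_triangle` by amalgamation, `distance_triangle` from the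
ball form of subtuple approximation), so relative compactness of a set means that every ultrafilter
containing it converges to some point of the ambient space.

If `A` is relatively compact, an ultrafilter of `r`-balls comes from tuples converging to some `X`.
These balls become arbitrarily close to subtuples of the single compact tuple `X^(r+1)`
(`exists_isSubVia_ball_of_distance_lt`). The subtuples of a compact tuple form a relatively compact
family (`exists_isSubVia_lim`): their carriers converge in the Hausdorff distance, their elements
stay in a compact cone, and Hausdorff-closedness puts the limit element on the limit carrier. An
ultrafilter that gets close to such a family converges.

Conversely, let the balls of radius `k + 1` converge along an ultrafilter to `L k`, for every `k`.
Being a subtuple is a closed relation up to isomorphism (`exists_isSubVia_of_near`), so `L k` is a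
subtuple of `L (k + 1)`, and the ball of radius `k` of `L (k + 1)` is isomorphic to a subtuple of `L
k`. That embedding need not be the inclusion; rigidity, with surjectivity of isometric
self-embeddings of compact spaces, upgrades it to a true containment (`IsSubVia.coversVia`). The
direct limit of the chain is then boundedly compact and carries a compatible family
(`exists_tuple_of_chain`). It lies between its own `k`-ball and itself at every `L k`, which makes
it the limit of the tuples. -/

/-! ### Relative compactness in terms of ultrafilters -/

/-- The pseudo-metric space of a symmetric distance function, with the topology `distTopology`. -/
@[reducible]
noncomputable def distPseudoEMetric {α : Type u} (d : α → α → ℝ≥0∞) (hrefl : ∀ x, d x x = 0)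
    (hsymm : ∀ x y, d x y = d y x) (htri : ∀ x y z, d x z ≤ d x y + d y z) :
    PseudoEMetricSpace α where
  edist := d
  edist_self := hrefl
  edist_comm := hsymm
  edist_triangle := htri

theorem distPseudoEMetric_topology {α : Type u} (d : α → α → ℝ≥0∞) (hrefl : ∀ x, d x x = 0)
    (hsymm : ∀ x y, d x y = d y x) (htri : ∀ x y z, d x z ≤ d x y + d y z) :
    (distPseudoEMetric d hrefl hsymm htri).toUniformSpace.toTopologicalSpace = distTopology d := by
  let _ := distPseudoEMetric d hrefl hsymm htri
  refine TopologicalSpace.ext_iff.2 fun s => ?_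
  rw [EMetric.isOpen_iff]
  refine forall₂_congr fun x _ => exists_congr fun ε => and_congr Iff.rfl ?_
  refine forall_congr' fun y => ?_
  change edist y x < ε → _ ↔ edist x y < ε → _
  rw [edist_comm]

/-- The ultrafilter is lifted to one on pairs `(c, s)` with `s ∈ S` and `c`, `s` arbitrarily close.
Its second projection converges by `hS`, and the first projection, which is `U`, has the same limit.
-/
theorem exists_le_nhds_of_forall_near {α : Type u} [PseudoEMetricSpace α] {S : Set α}
    (hS : ∀ V : Ultrafilter α, S ∈ V → ∃ x, (V : Filter α) ≤ 𝓝 x) (U : Ultrafilter α)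
    (hU : ∀ ε : ℝ≥0∞, 0 < ε → ∀ᶠ c in U, ∃ s ∈ S, edist c s < ε) :
    ∃ x, (U : Filter α) ≤ 𝓝 x := by
  set F : Filter (α × α) := comap Prod.fst (U : Filter α) ⊓ (uniformity α ⊓ 𝓟 {p | p.2 ∈ S})
    with hF
  -- Properness of `F` is exactly the assumption that `U` comes close to `S`.
  have hne : F.NeBot := by
    rw [hF, Filter.inf_neBot_iff]
    rintro s ⟨T, hT, hTs⟩ s' hs'
    rw [mem_inf_principal] at hs'
    obtain ⟨ε, hε, hE⟩ := mem_uniformity_edist.1 hs'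
    obtain ⟨c, hcT, b, hbS, hcb⟩ := (U.nonempty_of_mem (inter_mem hT (hU ε hε)))
    exact ⟨(c, b), hTs hcT, hE hcb hbS⟩
  set W := @Ultrafilter.of _ F hne with hW
  have hWF : (W : Filter (α × α)) ≤ F := @Ultrafilter.of_le _ F hne
  have h1 : W.map Prod.fst = U := by
    exact Ultrafilter.coe_le_coe.1 (map_le_iff_le_comap.2 (hWF.trans inf_le_left))
  obtain ⟨x, hx⟩ := hS (W.map Prod.snd) (by
    have : (W : Filter (α × α)) ≤ 𝓟 {p | p.2 ∈ S} := hWF.trans (inf_le_right.trans inf_le_right)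
    exact this (mem_principal_self _))
  refine ⟨x, ?_⟩
  rw [← h1]
  change Tendsto Prod.fst (W : Filter (α × α)) (𝓝 x)
  have h2 : Tendsto Prod.snd (W : Filter (α × α)) (𝓝 x) := hx
  rw [Uniform.tendsto_nhds_left] at h2 ⊢
  have h3 : Tendsto (fun p : α × α => (p.1, p.2)) W (uniformity α) :=
    hWF.trans (inf_le_right.trans inf_le_left)
  exact h3.uniformity_trans h2

/-- Only ultrafilters on `A` itself have to be tested: one on the closure is arbitrarily close to
`A`. -/
theorem isCompact_closure_iff_ultrafilter {α : Type u} [PseudoEMetricSpace α] {A : Set α} :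
    IsCompact (closure A) ↔ ∀ U : Ultrafilter α, A ∈ U → ∃ x, (U : Filter α) ≤ 𝓝 x := by
  rw [isCompact_iff_ultrafilter_le_nhds]
  constructor
  · intro h U hU
    obtain ⟨x, -, hx⟩ := h U (le_principal_iff.2 (mem_of_superset hU subset_closure))
    exact ⟨x, hx⟩
  · intro h U hU
    obtain ⟨x, hx⟩ := exists_le_nhds_of_forall_near h U (fun ε hε =>
      mem_of_superset (le_principal_iff.1 hU) fun c hc => EMetric.mem_closure_iff.1 hc ε hε)
    exact ⟨x, isClosed_closure.mem_of_tendsto hx (le_principal_iff.1 hU), hx⟩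

theorem isRelCompactDist_iff {α : Type u} {d : α → α → ℝ≥0∞} (hrefl : ∀ x, d x x = 0)
    (hsymm : ∀ x y, d x y = d y x) (htri : ∀ x y z, d x z ≤ d x y + d y z) {A : Set α} :
    IsRelCompactDist d A ↔
      ∀ U : Ultrafilter α, A ∈ U → ∃ x, ∀ ε : ℝ≥0∞, 0 < ε → ∀ᶠ y in U, d x y < ε := by
  let _ := distPseudoEMetric d hrefl hsymm htri
  unfold IsRelCompactDist
  rw [← distPseudoEMetric_topology d hrefl hsymm htri, isCompact_closure_iff_ultrafilter]
  refine forall₂_congr fun U _ => exists_congr fun x => ?_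
  rw [Metric.nhds_basis_eball.ge_iff]
  refine forall₂_congr fun ε _ => ?_
  change _ ↔ {y | edist x y < ε} ∈ U
  simp only [edist_comm x]
  rfl

theorem exists_lim_of_forall_near {α : Type u} {d : α → α → ℝ≥0∞} (hrefl : ∀ x, d x x = 0)
    (hsymm : ∀ x y, d x y = d y x) (htri : ∀ x y z, d x z ≤ d x y + d y z) {S : Set α}
    (hS : ∀ V : Ultrafilter α, S ∈ V → ∃ x, ∀ ε : ℝ≥0∞, 0 < ε → ∀ᶠ y in V, d x y < ε)
    (U : Ultrafilter α) (hU : ∀ ε : ℝ≥0∞, 0 < ε → ∀ᶠ c in U, ∃ s ∈ S, d c s < ε) :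
    ∃ x, ∀ ε : ℝ≥0∞, 0 < ε → ∀ᶠ y in U, d x y < ε := by
  let _ := distPseudoEMetric d hrefl hsymm htri
  have key : ∀ (V : Ultrafilter α) (x : α),
      (V : Filter α) ≤ 𝓝 x ↔ ∀ ε : ℝ≥0∞, 0 < ε → ∀ᶠ y in V, d x y < ε := by
    intro V x
    rw [Metric.nhds_basis_eball.ge_iff]
    refine forall₂_congr fun ε _ => ?_
    change _ ↔ {y | edist x y < ε} ∈ V
    simp only [edist_comm x]
    rfl
  simp only [← key] at hS ⊢
  exact exists_le_nhds_of_forall_near hS U hU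

/-! ### Isometric self-embeddings of compact spaces -/

theorem Isometry.iterate {X : Type u} [PseudoEMetricSpace X] {f : X → X} (hf : Isometry f) (n : ℕ) :
    Isometry f^[n] := by
  induction n with
  | zero => exact isometry_id
  | succ n ih => exact ih.comp hf

/-- An isometric embedding of a compact space into itself is surjective. -/
theorem Isometry.surjective_of_compactSpace {X : Type u} [MetricSpace X] [CompactSpace X]
    {f : X → X} (hf : Isometry f) : Function.Surjective f := by
  intro x
  by_contra hx
  have hcl : IsClosed (range f) := (isCompact_range hf.continuous).isClosed
  obtain ⟨ε, hε, hball⟩ := Metric.isOpen_iff.1 hcl.isOpen_compl x hx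
  obtain ⟨a, -, φ, hφ, hlim⟩ := isCompact_univ.tendsto_subseq (x := fun n => f^[n] x)
    (fun _ => mem_univ _)
  have hc := hlim.cauchySeq
  obtain ⟨N, hN⟩ := Metric.cauchySeq_iff'.1 hc ε hε
  have h1 := hN (N + 1) (Nat.le_succ N)
  have hlt : φ N < φ (N + 1) := hφ (Nat.lt_succ_self N)
  obtain ⟨k, hk⟩ := Nat.exists_eq_add_of_lt hlt
  -- Cancelling the isometry `f^[φ N]` turns two close points of the orbit into a point of the range
  -- within `ε` of `x`.
  have h2 : f^[φ (N + 1)] x = f^[φ N] (f (f^[k] x)) := by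
    rw [hk, add_assoc, Function.iterate_add_apply, Function.iterate_succ_apply']
  have h3 : dist (f^[φ N] (f (f^[k] x))) (f^[φ N] x) = dist (f (f^[k] x)) x :=
    (Isometry.iterate hf (φ N)).dist_eq _ _
  simp only [Function.comp_apply, h2, h3] at h1
  exact hball (Metric.mem_ball.2 h1) ⟨_, rfl⟩

/-! ### The Gromov-Hausdorff-functor distance -/

instance {X Y Z : Type*} [Nonempty Z] [MetricSpace Z] [MetricSpace X] [MetricSpace Y]
    [CompactSpace X] [CompactSpace Y] {Φ : Z → X} {Ψ : Z → Y} (hΦ : Isometry Φ)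
    (hΨ : Isometry Ψ) : CompactSpace (Metric.GlueSpace hΦ hΨ) := by
  have h : range (Metric.toGlueL hΦ hΨ) ∪ range (Metric.toGlueR hΦ hΨ) = univ := by
    refine eq_univ_of_forall fun z => ?_
    obtain ⟨x | y, rfl⟩ := Quotient.exists_rep z
    · exact Or.inl ⟨x, rfl⟩
    · exact Or.inr ⟨y, rfl⟩
  refine ⟨h ▸ ?_⟩
  exact (isCompact_range (Metric.toGlueL_isometry hΦ hΨ).continuous).union
    (isCompact_range (Metric.toGlueR_isometry hΦ hΨ).continuous)

namespace CompMet

theorem Hom.range_comp {X Y Z : CompMet.{u}} (g : Y.Hom Z) (f : X.Hom Y) :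
    range (g.comp f) = g '' range f :=
  Set.range_comp g f

/-- Two compact metric spaces embedded isometrically have an amalgam. -/
theorem exists_amalgam {X Y Z : CompMet.{u}} [Nonempty Z] (f : Z.Hom X) (g : Z.Hom Y) :
    ∃ (W : CompMet.{u}) (f' : X.Hom W) (g' : Y.Hom W), f'.comp f = g'.comp g :=
  ⟨⟨Metric.GlueSpace f.isometry g.isometry⟩,
    ⟨_, Metric.toGlueL_isometry f.isometry g.isometry⟩,
    ⟨_, Metric.toGlueR_isometry f.isometry g.isometry⟩,
    Hom.ext fun z => congrFun (Metric.toGlue_commute f.isometry g.isometry) z⟩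

end CompMet

namespace MetFunctor

variable {F : MetFunctor.{u, v}}

namespace Pair

theorem ghf_lt_iff {P Q : F.Pair} {ε : ℝ≥0∞} :
    ghf P Q < ε ↔ ∃ (Z : CompMet.{u}) (f : P.space.Hom Z) (g : Q.space.Hom Z),
      Metric.hausdorffEDist (range f) (range g) < ε ∧
        edist (F.map f P.pt) (F.map g Q.pt) < ε := by
  simp only [ghf, iInf_lt_iff, max_lt_iff]

theorem ghf_le {P Q : F.Pair} {Z : CompMet.{u}} (f : P.space.Hom Z) (g : Q.space.Hom Z) :
    ghf P Q ≤ max (Metric.hausdorffEDist (range f) (range g))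
      (edist (F.map f P.pt) (F.map g Q.pt)) :=
  iInf_le_of_le Z (iInf_le_of_le f (iInf_le _ g))

theorem ghf_self (P : F.Pair) : ghf P P = 0 := by
  refine le_antisymm ((ghf_le (CompMet.Hom.id _) (CompMet.Hom.id _)).trans ?_) bot_le
  simp

/-- Two nearly optimal ambient spaces are glued along their copies of `Q`; the gluing requires `Q`
to be nonempty. -/
theorem ghf_triangle (P Q R : F.Pair) [Nonempty Q.space] :
    ghf P R ≤ ghf P Q + ghf Q R := by
  refine ENNReal.le_of_forall_pos_le_add fun ε hε hfin => ?_
  obtain ⟨h1, h2⟩ := ENNReal.add_lt_top.1 hfin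
  have hε' : (ε / 2 : ℝ≥0∞) ≠ 0 := by simpa using hε.ne'
  obtain ⟨Z, f, g, hZ, hZ'⟩ := ghf_lt_iff.1 (ENNReal.lt_add_right h1.ne hε')
  obtain ⟨Z₂, f₂, g₂, hZ₂, hZ₂'⟩ := ghf_lt_iff.1 (ENNReal.lt_add_right h2.ne hε')
  obtain ⟨W, k, k₂, hk⟩ := CompMet.exists_amalgam g f₂
  have e : ghf P Q + ghf Q R + ε = (ghf P Q + ε / 2) + (ghf Q R + ε / 2) := by
    conv_lhs => rw [← ENNReal.add_halves (ε : ℝ≥0∞)]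
    ring
  rw [e]
  refine (ghf_le (k.comp f) (k₂.comp g₂)).trans (max_le ?_ ?_)
  · refine (Metric.hausdorffEDist_triangle (t := range (k.comp g))).trans (add_le_add ?_ ?_)
    · rw [CompMet.Hom.range_comp, CompMet.Hom.range_comp, Metric.hausdorffEDist_image k.isometry]
      exact hZ.le
    · rw [hk, CompMet.Hom.range_comp, CompMet.Hom.range_comp,
        Metric.hausdorffEDist_image k₂.isometry]
      exact hZ₂.le
  · refine (edist_triangle _ (F.map (k.comp g) Q.pt) _).trans (add_le_add ?_ ?_)
    · rw [F.map_comp, F.map_comp, (F.isometry_map k).edist_eq]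
      exact hZ'.le
    · rw [hk, F.map_comp, F.map_comp, (F.isometry_map k₂).edist_eq]
      exact hZ₂'.le

end Pair

/-! ### Pairs at distance zero -/

/-- The 1-Lipschitz functions with values in `[0, C]`. -/
def lipschitzFunctions (X : CompMet.{u}) (C : ℝ) : Set (BoundedContinuousFunction X ℝ) :=
  {h | LipschitzWith 1 h ∧ ∀ x, h x ∈ Icc 0 C}

theorem isCompact_lipschitzFunctions (X : CompMet.{u}) (C : ℝ) :
    IsCompact (lipschitzFunctions X C) := by
  refine BoundedContinuousFunction.arzela_ascoli₂ (Icc 0 C) isCompact_Icc _ ?_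
    (fun h x hh => hh.2 x) ?_
  · have hc : ∀ x : X, Continuous fun h : BoundedContinuousFunction X ℝ => h x := fun x =>
      continuous_eval_const x
    simp only [lipschitzFunctions, LipschitzWith, ofPred_and, ofPred_forall]
    refine IsClosed.inter ?_ ?_
    · exact isClosed_iInter fun x => isClosed_iInter fun y =>
        isClosed_le ((hc x).edist (hc y)) continuous_const
    · exact isClosed_iInter fun x => isClosed_Icc.preimage (hc x)
  · refine UniformEquicontinuous.equicontinuous ?_
    exact LipschitzWith.uniformEquicontinuous _ 1 fun h => h.2.1

/-- The compact space of pairs of bounded 1-Lipschitz functions. -/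
noncomputable def lipschitzSpace (X Y : CompMet.{u}) (C : ℝ) : CompMet.{u} where
  carrier := {w : BoundedContinuousFunction X ℝ × BoundedContinuousFunction Y ℝ //
    w ∈ lipschitzFunctions X C ×ˢ lipschitzFunctions Y C}
  compact := isCompact_iff_compactSpace.1
    ((isCompact_lipschitzFunctions X C).prod (isCompact_lipschitzFunctions Y C))

/-- The distance to the points of an embedded compact space. -/
noncomputable def distFunction {X Z : CompMet.{u}} (f : X.Hom Z) (z : Z) :
    BoundedContinuousFunction X ℝ :=
  BoundedContinuousFunction.mkOfCompact
    ⟨fun x => dist z (f x), continuous_const.dist f.isometry.continuous⟩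

theorem distFunction_apply {X Z : CompMet.{u}} (f : X.Hom Z) (z : Z) (x : X) :
    distFunction f z x = dist z (f x) := rfl

theorem distFunction_mem {X Z : CompMet.{u}} (f : X.Hom Z) (z : Z) {C : ℝ}
    (h : ∀ x, dist z (f x) ≤ C) : distFunction f z ∈ lipschitzFunctions X C := by
  refine ⟨LipschitzWith.of_dist_le_mul fun x y => ?_, fun x => ⟨dist_nonneg, h x⟩⟩
  rw [distFunction_apply, distFunction_apply, NNReal.coe_one, one_mul, ← f.isometry.dist_eq]
  exact dist_dist_dist_le_right _ _ _

theorem dist_distFunction_le {X Z : CompMet.{u}} (f : X.Hom Z) (z z' : Z) :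
    dist (distFunction f z) (distFunction f z') ≤ dist z z' :=
  (BoundedContinuousFunction.dist_le dist_nonneg).2 fun _ => dist_dist_dist_le_left _ _ _

/-- As for the Kuratowski embedding, the supremum is attained at the preimage of `z`. One of the two
points in the range suffices, so the pair of distance functions to `X` and `Y` is isometric on the
union of both images. -/
theorem dist_distFunction_of_mem {X Z : CompMet.{u}} (f : X.Hom Z) {z : Z} (z' : Z)
    (hz : z ∈ range f) : dist (distFunction f z) (distFunction f z') = dist z z' := by
  refine le_antisymm (dist_distFunction_le f z z') ?_
  obtain ⟨x, rfl⟩ := hz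
  have := BoundedContinuousFunction.dist_coe_le_dist (f := distFunction f (f x))
    (g := distFunction f z') x
  rwa [distFunction_apply, distFunction_apply, dist_self, dist_comm, Real.dist_0_eq_abs,
    abs_of_nonneg dist_nonneg, dist_comm] at this

/-- Two compact spaces with bounded distance in some compact space embed into the space
`lipschitzSpace`, which depends on the bound only. -/
theorem exists_hom_lipschitzSpace {X Y Z : CompMet.{u}} {C : ℝ} (f : X.Hom Z) (g : Y.Hom Z)
    (hC : ∀ z ∈ range f ∪ range g, (∀ x, dist z (f x) ≤ C) ∧ ∀ y, dist z (g y) ≤ C) :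
    ∃ (D : CompMet.{u}) (f' : X.Hom D) (g' : Y.Hom D) (i : D.Hom Z)
      (_ : D.Hom (lipschitzSpace X Y C)), i.comp f' = f ∧ i.comp g' = g := by
  have hcomp : IsCompact (range f ∪ range g) :=
    (isCompact_range f.isometry.continuous).union (isCompact_range g.isometry.continuous)
  let D : Compacts Z := ⟨range f ∪ range g, hcomp⟩
  refine ⟨CompMet.ofSet D, ⟨fun x => ⟨f x, Or.inl ⟨x, rfl⟩⟩, f.isometry⟩,
    ⟨fun x => ⟨g x, Or.inr ⟨x, rfl⟩⟩, g.isometry⟩, CompMet.inclSpace D,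
    ⟨fun z => ⟨(distFunction f z.1, distFunction g z.1),
      distFunction_mem f _ (hC _ z.2).1, distFunction_mem g _ (hC _ z.2).2⟩,
      Isometry.of_dist_eq fun z z' => ?_⟩, rfl, rfl⟩
  change max (dist (distFunction f z.1) (distFunction f z'.1))
    (dist (distFunction g z.1) (distFunction g z'.1)) = dist z.1 z'.1
  rcases z.2 with h | h
  · rw [dist_distFunction_of_mem f _ h]
    exact max_eq_left (dist_distFunction_le _ _ _)
  · rw [dist_distFunction_of_mem g _ h]
    exact max_eq_right (dist_distFunction_le _ _ _)

/-- Isometric embeddings between compact spaces have uniformly convergent subsequences. -/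
theorem exists_hom_subseq {X W : CompMet.{u}} (f : ℕ → X.Hom W) :
    ∃ (g : X.Hom W) (φ : ℕ → ℕ), StrictMono φ ∧
      ∀ ε : ℝ, 0 < ε → ∀ᶠ n in atTop, ∀ x, dist (f (φ n) x) (g x) < ε := by
  have hcpt : IsCompact {h : BoundedContinuousFunction X W | Isometry h} := by
    refine BoundedContinuousFunction.arzela_ascoli₁ _ ?_ ?_
    · have hc : ∀ x : X, Continuous fun h : BoundedContinuousFunction X W => h x := fun x =>
        continuous_eval_const x
      simp only [Isometry, ofPred_forall]
      exact isClosed_iInter fun x => isClosed_iInter fun y =>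
        isClosed_eq ((hc x).edist (hc y)) continuous_const
    · refine UniformEquicontinuous.equicontinuous ?_
      exact LipschitzWith.uniformEquicontinuous _ 1 fun h => h.2.lipschitz
  obtain ⟨g, hg, φ, hφ, hlim⟩ := hcpt.tendsto_subseq
    (x := fun n => BoundedContinuousFunction.mkOfCompact ⟨f n, (f n).isometry.continuous⟩)
    (fun n => (f n).isometry)
  refine ⟨⟨g, hg⟩, φ, hφ, fun ε hε => ?_⟩
  filter_upwards [Metric.tendsto_nhds.1 hlim ε hε] with n hn x
  exact (BoundedContinuousFunction.dist_coe_le_dist x).trans_lt hn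

/-- The ambient space in the infimum varies with `ε`; a fixed compact one is needed to extract
convergent subsequences of embeddings. -/
theorem Pair.exists_common_space {P Q : F.Pair} [Nonempty P.space] (h : P.ghf Q = 0) :
    ∃ W : CompMet.{u}, ∀ ε : ℝ≥0∞, 0 < ε →
      ∃ (f : P.space.Hom W) (g : Q.space.Hom W), Metric.hausdorffEDist (range f) (range g) < ε ∧
        edist (F.map f P.pt) (F.map g Q.pt) < ε := by
  set A := Metric.diam (univ : Set P.space)
  set B := Metric.diam (univ : Set Q.space)
  have hA : ∀ x y : P.space, dist x y ≤ A := fun x y =>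
    Metric.dist_le_diam_of_mem isCompact_univ.isBounded (mem_univ _) (mem_univ _)
  have hB : ∀ x y : Q.space, dist x y ≤ B := fun x y =>
    Metric.dist_le_diam_of_mem isCompact_univ.isBounded (mem_univ _) (mem_univ _)
  have hA0 : 0 ≤ A := Metric.diam_nonneg
  have hB0 : 0 ≤ B := Metric.diam_nonneg
  -- Once the Hausdorff distance is below `1`, all distances between points of the two images are at
  -- most `A + 1 + B`.
  refine ⟨lipschitzSpace P.space Q.space (A + 1 + B), fun ε hε => ?_⟩
  have hlt : P.ghf Q < min ε 1 := by
    rw [h]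
    exact lt_min hε one_pos
  obtain ⟨Z, f, g, hH, he⟩ := ghf_lt_iff.1 hlt
  have hfg : ∀ x y, dist (f x) (g y) ≤ A + 1 + B := by
    intro x y
    obtain ⟨_, ⟨y', rfl⟩, hy'⟩ := Metric.exists_edist_lt_of_hausdorffEDist_lt (mem_range_self x)
      (hH.trans_le (min_le_right _ _))
    have h1 : dist (f x) (g y') < 1 := by
      rw [edist_dist] at hy'
      simpa using hy'
    have h2 := dist_triangle (f x) (g y') (g y)
    rw [g.isometry.dist_eq] at h2
    linarith [hB y' y]
  obtain ⟨D, f', g', i, k, rfl, rfl⟩ := exists_hom_lipschitzSpace (C := A + 1 + B) f g (by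
    rintro _ (⟨x, rfl⟩ | ⟨y, rfl⟩)
    · refine ⟨fun x' => ?_, hfg x⟩
      rw [f.isometry.dist_eq]
      linarith [hA x x']
    · refine ⟨fun x' => by rw [dist_comm]; exact hfg x' y, fun y' => ?_⟩
      rw [g.isometry.dist_eq]
      linarith [hB y y'])
  -- The union `D` of the images embeds in both ambient spaces, and `F` sends embeddings to
  -- isometries, so the estimates pass through `D`.
  refine ⟨k.comp f', k.comp g', ?_, ?_⟩
  · rw [CompMet.Hom.range_comp, CompMet.Hom.range_comp, Metric.hausdorffEDist_image k.isometry]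
    rw [CompMet.Hom.range_comp, CompMet.Hom.range_comp,
      Metric.hausdorffEDist_image i.isometry] at hH
    exact hH.trans_le (min_le_left _ _)
  · rw [F.map_comp, F.map_comp, (F.isometry_map k).edist_eq]
    rw [F.map_comp, F.map_comp, (F.isometry_map i).edist_eq] at he
    exact he.trans_le (min_le_left _ _)

theorem range_subset_of_tendsto {X Y W : CompMet.{u}} {f : X.Hom W} {g : Y.Hom W}
    {fs : ℕ → X.Hom W} {gs : ℕ → Y.Hom W}
    (hf : ∀ ε : ℝ, 0 < ε → ∀ᶠ n in atTop, ∀ x, dist (fs n x) (f x) < ε)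
    (hg : ∀ ε : ℝ, 0 < ε → ∀ᶠ n in atTop, ∀ x, dist (gs n x) (g x) < ε)
    (h : Tendsto (fun n => Metric.hausdorffEDist (range (fs n)) (range (gs n))) atTop (𝓝 0)) :
    range f ⊆ range g := by
  rintro _ ⟨x, rfl⟩
  rw [← (isCompact_range g.isometry.continuous).isClosed.closure_eq]
  refine Metric.mem_closure_iff.2 fun ε hε => ?_
  have hε' : (0 : ℝ≥0∞) < ENNReal.ofReal (ε / 3) := by simpa using hε
  obtain ⟨n, h1, h2, h3⟩ := ((hf (ε / 3) (by positivity)).and ((hg (ε / 3) (by positivity)).and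
    (h.eventually_lt_const hε'))).exists
  obtain ⟨_, ⟨y, rfl⟩, hy⟩ := Metric.exists_edist_lt_of_hausdorffEDist_lt (mem_range_self x) h3
  rw [edist_dist, ENNReal.ofReal_lt_ofReal_iff (by positivity)] at hy
  refine ⟨g y, mem_range_self y, ?_⟩
  have h4 := dist_triangle4 (f x) (fs n x) (gs n y) (g y)
  rw [dist_comm (f x) (fs n x)] at h4
  linarith [h1 x, h2 y]

/-- Pairs at distance zero are isomorphic. -/
theorem Pair.iso_of_ghf_eq_zero (hF : F.PointwiseContinuous) {P Q : F.Pair} [Nonempty P.space]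
    (h : P.ghf Q = 0) : P.Iso Q := by
  obtain ⟨W, hW⟩ := exists_common_space h
  have hpos : ∀ n : ℕ, (0 : ℝ≥0∞) < ((n : ℝ≥0∞) + 1)⁻¹ := fun n => by simp
  choose fs gs hH he using fun n : ℕ => hW _ (hpos n)
  have hlim0 : Tendsto (fun n : ℕ => ((n : ℝ≥0∞) + 1)⁻¹) atTop (𝓝 0) := by
    have := (tendsto_add_atTop_iff_nat 1).2 ENNReal.tendsto_inv_nat_nhds_zero
    simpa using this
  obtain ⟨f, φ, hφ, hf⟩ := exists_hom_subseq fs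
  obtain ⟨g, ψ, hψ, hg⟩ := exists_hom_subseq (gs ∘ φ)
  have hf' : ∀ ε : ℝ, 0 < ε → ∀ᶠ n in atTop, ∀ x, dist (fs (φ (ψ n)) x) (f x) < ε :=
    fun ε hε => hψ.tendsto_atTop.eventually (hf ε hε)
  have hφψ : Tendsto (fun n => φ (ψ n)) atTop atTop :=
    hφ.tendsto_atTop.comp hψ.tendsto_atTop
  have hH' : Tendsto (fun n => Metric.hausdorffEDist (range (fs (φ (ψ n))))
      (range (gs (φ (ψ n))))) atTop (𝓝 0) :=
    tendsto_of_tendsto_of_tendsto_of_le_of_le tendsto_const_nhds (hlim0.comp hφψ)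
      (fun _ => bot_le) fun n => (hH _).le
  have hrange : range f = range g := by
    refine Subset.antisymm (range_subset_of_tendsto hf' hg hH') (range_subset_of_tendsto hg hf' ?_)
    simpa only [Metric.hausdorffEDist_comm, Function.comp_apply] using hH'
  have hmap : F.map f P.pt = F.map g Q.pt := by
    have h1 := hF _ _ f (fun n => fs (φ (ψ n))) (fun x => Metric.tendsto_nhds.2 fun ε hε =>
      (hf' ε hε).mono fun n hn => hn x) P.pt
    have h2 := hF _ _ g (fun n => gs (φ (ψ n))) (fun x => Metric.tendsto_nhds.2 fun ε hε =>
      (hg ε hε).mono fun n hn => hn x) Q.pt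
    have h3 : Tendsto (fun n => edist (F.map (fs (φ (ψ n))) P.pt) (F.map (gs (φ (ψ n))) Q.pt))
        atTop (𝓝 0) :=
      tendsto_of_tendsto_of_tendsto_of_le_of_le tendsto_const_nhds (hlim0.comp hφψ)
        (fun _ => bot_le) fun n => (he _).le
    exact edist_eq_zero.1 (tendsto_nhds_unique (h1.edist h2) h3)
  -- Since the limit embeddings have equal ranges, `g⁻¹ ∘ f` is the required isometry.
  choose e he' using fun x => (hrange ▸ mem_range_self x : f x ∈ range g)
  choose e' he'' using fun y => (hrange ▸ mem_range_self y : g y ∈ range f)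
  let E : P.space ≃ᵢ Q.space :=
    { toFun := e
      invFun := e'
      left_inv := fun x => f.isometry.injective (by rw [he'', he'])
      right_inv := fun y => g.isometry.injective (by rw [he', he''])
      isometry_toFun := fun x y => by
        rw [← g.isometry.edist_eq, he', he', f.isometry.edist_eq] }
  refine ⟨E, (F.isometry_map g).injective ?_⟩
  rw [← hmap, ← F.map_comp]
  congr 1
  exact CompMet.Hom.ext he'

theorem PointwiseContinuous.pointed (hF : F.PointwiseContinuous) :
    F.pointed.PointwiseContinuous :=
  fun X Y f fs h a => (h a.1).prodMk_nhds (hF X Y f fs h a.2)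

end MetFunctor

namespace PosMetFunctor.Truncation.Tuple

variable {τ : PosMetFunctor.{u, v}} {t : τ.Truncation}

instance (P : τ.pointed.Pair) : Nonempty P.space := ⟨P.pt.1⟩

/-! ### Subtuples in terms of isometric embeddings -/

/-- The restriction of a tuple along an isometric embedding of a compact space. -/
def restr (Y : t.Tuple) {C : CompMet.{u}} (g : C → Y.space) (hg : Isometry g) : τ.obj C :=
  t.tmap (Y := CompMet.ofSet ⟨range g, isCompact_range hg.continuous⟩)
    ⟨fun x => ⟨g x, mem_range_self x⟩, hg⟩ (Y.a.val _)

/-- By compatibility of the family, the restriction may be computed from any compact set containing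
the image. -/
theorem restr_eq (Y : t.Tuple) {C : CompMet.{u}} {g : C → Y.space} (hg : Isometry g)
    (K : Compacts Y.space) (h : ∀ x, g x ∈ K) :
    Y.restr g hg = t.tmap (Y := CompMet.ofSet K) ⟨fun x => ⟨g x, h x⟩, hg⟩ (Y.a.val K) := by
  have hK : (⟨range g, isCompact_range hg.continuous⟩ : Compacts Y.space) ≤ K := by
    rintro _ ⟨x, rfl⟩
    exact h x
  rw [restr, ← Y.a.compat hK, ← t.tmap_comp]
  rfl

theorem restr_comp (Y : t.Tuple) {C D : CompMet.{u}} {g : C → Y.space} (hg : Isometry g)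
    (f : D.Hom C) : Y.restr (fun x => g (f x)) (hg.comp f.isometry) = t.tmap f (Y.restr g hg) := by
  rw [restr_eq Y _ ⟨range g, isCompact_range hg.continuous⟩ fun x => mem_range_self _, restr,
    ← t.tmap_comp]
  rfl

theorem restr_ofPair (P : τ.pointed.Pair) {C : CompMet.{u}} (g : C.Hom P.space) :
    (ofPair t P).restr g g.isometry = t.tmap g P.pt.2 :=
  (t.tmap_comp _ _ _).symm

theorem restr_val (Y : t.Tuple) (K : Compacts Y.space) :
    Y.restr (C := CompMet.ofSet K) Subtype.val isometry_subtype_coe = Y.a.val K := by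
  exact (restr_eq Y _ K fun x : CompMet.ofSet K => x.2).trans (t.tmap_id _ _)

/-- The pair `P` is isomorphic to a subtuple of `Y` via the map `g`. -/
structure IsSubVia (Y : t.Tuple) (P : τ.pointed.Pair) (g : P.space → Y.space) : Prop where
  isometry : Isometry g
  map_o : g P.pt.1 = Y.o
  le : P.pt.2 ≤ Y.restr g isometry

/-- The image of the pair `P` under `g` contains the truncated ball `Y^(r)`. -/
def CoversVia (Y : t.Tuple) (P : τ.pointed.Pair) (g : P.space → Y.space) (r : ℝ≥0) : Prop :=
  ∃ s : (CompMet.ofSet (Y.ball r).carrier).Hom P.space, (∀ x, g (s x) = x.1) ∧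
    Y.a.val (Y.ball r).carrier ≤ t.tmap s P.pt.2

/-- The pair `P` is isomorphic to a subtuple of `Y` which contains the truncated ball `Y^(r)`. -/
def Between (Y : t.Tuple) (r : ℝ≥0) (P : τ.pointed.Pair) : Prop :=
  ∃ g, Y.IsSubVia P g ∧ Y.CoversVia P g r

theorem Sub.isSubVia {Y : t.Tuple} (S : Y.Sub) : Y.IsSubVia S.toPair Subtype.val where
  isometry := isometry_subtype_coe
  map_o := rfl
  le := S.a_le.trans_eq (restr_val Y S.carrier).symm

theorem Sub.coversVia {Y : t.Tuple} {S : Y.Sub} {r : ℝ≥0} (h : Y.ball r ≤ S) :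
    Y.CoversVia S.toPair Subtype.val r :=
  ⟨CompMet.incl h.1, fun _ => rfl, h.2⟩

/-- Transporting `P` onto the image of `g` makes it an honest subtuple. This translates between
abstract embedded pairs, which compose easily, and the subsets in the definitions and assumptions.
-/
theorem IsSubVia.exists_sub {Y : t.Tuple} {P : τ.pointed.Pair} {g : P.space → Y.space}
    (h : Y.IsSubVia P g) :
    ∃ S : Y.Sub, P.Iso S.toPair ∧ ∀ r, Y.CoversVia P g r → Y.ball r ≤ S := by
  let K : Compacts Y.space := ⟨range g, isCompact_range h.isometry.continuous⟩
  let e : P.space ≃ᵢ CompMet.ofSet K := h.isometry.isometryEquivOnRange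
  have hle : P.pt.2 ≤ t.tmap (CompMet.Hom.ofEquiv e) (Y.a.val K) := h.le
  refine ⟨⟨K, ⟨_, h.map_o⟩, τ.map (CompMet.Hom.ofEquiv e) P.pt.2,
    (τ.monotone_map _ hle).trans (t.map_tmap_le _ _)⟩,
    ⟨e, Prod.ext (Subtype.ext h.map_o) rfl⟩, ?_⟩
  rintro r ⟨s, hs, hs'⟩
  have hsub : (Y.ball r).carrier ≤ K := fun x hx => ⟨s ⟨x, hx⟩, hs ⟨x, hx⟩⟩
  refine ⟨hsub, hs'.trans_eq ?_⟩
  have : CompMet.incl hsub = (CompMet.Hom.ofEquiv e).comp s :=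
    CompMet.Hom.ext fun x => Subtype.ext (hs x).symm
  change _ = t.tmap (CompMet.incl hsub) (τ.map (CompMet.Hom.ofEquiv e) P.pt.2)
  rw [this, t.tmap_comp, t.tmap_map]

theorem IsSubVia.comp {Y : t.Tuple} {P Q : τ.pointed.Pair} {g : P.space → Y.space}
    {f : Q.space → P.space} (hg : Y.IsSubVia P g) (hf : (ofPair t P).IsSubVia Q f) :
    Y.IsSubVia Q (fun x => g (f x)) where
  isometry := hg.isometry.comp hf.isometry
  map_o := (congrArg g hf.map_o).trans hg.map_o
  le := by
    rw [restr_comp Y hg.isometry ⟨f, hf.isometry⟩]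
    refine hf.le.trans ?_
    rw [restr_ofPair P ⟨f, hf.isometry⟩]
    exact t.monotone_tmap _ hg.le

theorem CoversVia.mono {Y : t.Tuple} {P : τ.pointed.Pair} {g : P.space → Y.space} {r r' : ℝ≥0}
    (h : Y.CoversVia P g r) (hr : r' ≤ r) : Y.CoversVia P g r' := by
  obtain ⟨s, hs, hs'⟩ := h
  have hsub : (Y.ball r').carrier ≤ (Y.ball r).carrier :=
    Metric.closedBall_subset_closedBall (NNReal.coe_le_coe.2 hr)
  refine ⟨s.comp (CompMet.incl hsub), fun x => hs _, ?_⟩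
  rw [t.tmap_comp, ← Y.a.compat hsub]
  exact t.monotone_tmap _ hs'

theorem CoversVia.comp {Y : t.Tuple} {P Q : τ.pointed.Pair} {g : P.space → Y.space}
    {f : Q.space → P.space} {r : ℝ≥0} (hg : Y.CoversVia P g r) (hi : Y.IsSubVia P g)
    (hf : (ofPair t P).CoversVia Q f r) : Y.CoversVia Q (fun x => g (f x)) r := by
  obtain ⟨s, hs, hs'⟩ := hg
  obtain ⟨s', hf1, hf2⟩ := hf
  -- Since `g` preserves distances to the distinguished point, the copy of `Y^(r)` in `P` lies in
  -- the ball of `P`.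
  have hmem : ∀ x, s x ∈ ((ofPair t P).ball r).carrier := fun x => by
    change dist (s x) P.pt.1 ≤ r
    rw [← hi.isometry.dist_eq, hs, hi.map_o]
    exact x.2
  let k : (CompMet.ofSet (Y.ball r).carrier).Hom (CompMet.ofSet ((ofPair t P).ball r).carrier) :=
    ⟨fun x => ⟨s x, hmem x⟩, s.isometry⟩
  refine ⟨s'.comp k, fun x => (congrArg g (hf1 (k x))).trans (hs x), hs'.trans ?_⟩
  rw [t.tmap_comp]
  have : t.tmap s P.pt.2 = t.tmap k ((ofPair t P).a.val ((ofPair t P).ball r).carrier) :=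
    t.tmap_comp (CompMet.inclSpace (X := P.space) ((ofPair t P).ball r).carrier) k P.pt.2
  rw [this]
  exact t.monotone_tmap _ hf2

theorem Between.mono {Y : t.Tuple} {P : τ.pointed.Pair} {r r' : ℝ≥0}
    (h : Y.Between r P) (hr : r' ≤ r) : Y.Between r' P :=
  let ⟨g, h1, h2⟩ := h
  ⟨g, h1, h2.mono hr⟩

theorem Between.comp {Y : t.Tuple} {P Q : τ.pointed.Pair} {r : ℝ≥0}
    (h : Y.Between r P) (h' : (ofPair t P).Between r Q) : Y.Between r Q :=
  let ⟨_, h1, h2⟩ := h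
  let ⟨_, h3, h4⟩ := h'
  ⟨_, h1.comp h3, h2.comp h1 h4⟩

theorem between_ball_of_le (Y : t.Tuple) {r R : ℝ≥0} (h : r ≤ R) :
    Y.Between r (Y.ball R).toPair := by
  refine ⟨_, (Y.ball R).isSubVia, CoversVia.mono (Sub.coversVia ?_) h⟩
  exact ⟨le_rfl, (Y.a.compat le_rfl).ge⟩

/-- A truncated ball of `Y` is a subtuple of every pair which contains it. -/
theorem Between.ball {Y : t.Tuple} {P : τ.pointed.Pair} {r : ℝ≥0} (h : Y.Between r P) :
    (ofPair t P).Between r (Y.ball r).toPair := by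
  obtain ⟨g, hg, s, hs, hs'⟩ := h
  refine ⟨s, ⟨s.isometry, hg.isometry.injective ?_, hs'.trans_eq (restr_ofPair P s).symm⟩, ?_⟩
  · exact (hs _).trans hg.map_o.symm
  · have hmem : ∀ x : ((ofPair t P).ball r).carrier, g x.1 ∈ (Y.ball r).carrier := fun x => by
      change dist _ _ ≤ _
      rw [← hg.map_o]
      exact (hg.isometry.dist_eq _ _).trans_le x.2
    let k : (CompMet.ofSet ((ofPair t P).ball r).carrier).Hom (CompMet.ofSet (Y.ball r).carrier) :=
      ⟨fun x => ⟨g x.1, hmem x⟩, hg.isometry.comp isometry_subtype_coe⟩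
    refine ⟨k, fun x => hg.isometry.injective (hs (k x)), ?_⟩
    change t.tmap (CompMet.inclSpace _) P.pt.2 ≤ t.tmap k (Y.a.val (Y.ball r).carrier)
    -- The ball of `P` is below that of `Y` because `P` is a subtuple of `Y`.
    refine (t.monotone_tmap _ hg.le).trans_eq ?_
    rw [← restr_comp, restr_eq Y _ (Y.ball r).carrier hmem]
    rfl

/-! ### The radius of a pair -/

/-- All points of the pair have distance at most `R` from the distinguished point. -/
def Within (P : τ.pointed.Pair) (R : ℝ≥0) : Prop :=
  ∀ x : P.space, dist x P.pt.1 ≤ R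

theorem within_ball (Y : t.Tuple) (R : ℝ≥0) : Within (Y.ball R).toPair R :=
  fun x => x.2

theorem Within.mono {P : τ.pointed.Pair} {R R' : ℝ≥0} (h : Within P R) (hR : R ≤ R') :
    Within P R' :=
  fun x => (h x).trans (NNReal.coe_le_coe.2 hR)

/-- One `η` comes from moving a point to the other space, the other from moving the distinguished
point. -/
theorem Within.of_ghf_lt {P Q : τ.pointed.Pair} {R η : ℝ≥0} (h : Within P R)
    (hPQ : P.ghf Q < η) : Within Q (R + 2 * η) := by
  obtain ⟨Z, f, g, hH, he⟩ := MetFunctor.Pair.ghf_lt_iff.1 hPQ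
  intro y
  rw [Metric.hausdorffEDist_comm] at hH
  obtain ⟨_, ⟨x, rfl⟩, hx⟩ := Metric.exists_edist_lt_of_hausdorffEDist_lt (mem_range_self y) hH
  have ho : edist (f P.pt.1) (g Q.pt.1) < η := (le_max_left _ _).trans_lt he
  rw [edist_lt_coe, ← NNReal.coe_lt_coe, coe_nndist] at hx ho
  have h1 := dist_triangle4 (g y) (f x) (f P.pt.1) (g Q.pt.1)
  rw [f.isometry.dist_eq, g.isometry.dist_eq] at h1
  push_cast
  linarith [h x]

theorem Within.exists_fit {Y : t.Tuple} {P : τ.pointed.Pair} {R : ℝ≥0} (hR : Within P R)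
    {g : P.space → Y.space} (h : Y.IsSubVia P g) :
    ∃ g', (ofPair t (Y.ball R).toPair).IsSubVia P g' ∧ ∀ r, Y.CoversVia P g r →
      (ofPair t (Y.ball R).toPair).CoversVia P g' r := by
  have hmem : ∀ x, g x ∈ (Y.ball R).carrier := fun x => by
    change dist _ _ ≤ _
    rw [← h.map_o, h.isometry.dist_eq]
    exact hR x
  let g' : P.space.Hom (Y.ball R).toPair.space := ⟨fun x => ⟨g x, hmem x⟩, h.isometry⟩
  refine ⟨g', ⟨g'.isometry, Subtype.ext h.map_o, h.le.trans_eq ?_⟩, ?_⟩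
  · rw [restr_ofPair (Y.ball R).toPair g', restr_eq Y _ _ hmem]
    rfl
  · rintro r ⟨s, hs, hs'⟩
    let k : (CompMet.ofSet ((ofPair t (Y.ball R).toPair).ball r).carrier).Hom
      (CompMet.ofSet (Y.ball r).carrier) := ⟨fun x => ⟨x.1.1, x.2⟩, fun _ _ => rfl⟩
    refine ⟨s.comp k, fun x => Subtype.ext (hs (k x)), ?_⟩
    rw [t.tmap_comp]
    refine le_trans (le_of_eq ?_) (t.monotone_tmap _ hs')
    let i : (CompMet.ofSet ((ofPair t (Y.ball R).toPair).ball r).carrier) → Y.space :=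
      fun x => x.1.1
    have hi : Isometry i := fun _ _ => rfl
    exact (restr_eq Y hi (Y.ball R).carrier fun x => x.1.2).symm.trans
      (restr_eq Y hi (Y.ball r).carrier fun x => x.2)

theorem Between.fit {Y : t.Tuple} {P : τ.pointed.Pair} {r R : ℝ≥0} (h : Y.Between r P)
    (hR : Within P R) : (ofPair t (Y.ball R).toPair).Between r P := by
  obtain ⟨g, hg, hc⟩ := h
  obtain ⟨g', hg', hc'⟩ := hR.exists_fit hg
  exact ⟨g', hg', hc' r hc⟩

/-! ### Transferring subtuples to nearby pairs -/

theorem exists_isSubVia_near (hsub : t.SubtupleApprox) {P P' : τ.pointed.Pair}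
    (Q : τ.pointed.Pair) {g : P'.space → P.space} (h : (ofPair t P).IsSubVia P' g) :
    ∃ Q' g', (ofPair t Q).IsSubVia Q' g' ∧ P'.ghf Q' ≤ P.ghf Q := by
  obtain ⟨S, hS, -⟩ := h.exists_sub
  obtain ⟨S', hS'⟩ := hsub P Q S
  refine ⟨_, _, S'.isSubVia, ?_⟩
  rwa [MetFunctor.Pair.ghf_congr hS (MetFunctor.Pair.Iso.refl _)]

/-- The workhorse for radii: a subtuple of `P` moves to the nearby `Q`, hence into `Y`. The
approximation costs `2 * η` of covered radius, and nothing beyond the radius `s` covered by `Q` can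
be covered. -/
theorem Between.exists_near (hsubBall : t.SubtupleApproxBall) {Y : t.Tuple}
    {P P' Q : τ.pointed.Pair} {r s ρ η : ℝ≥0} (hQ : Y.Between s Q) (hPQ : P.ghf Q < η)
    (hP' : (ofPair t P).Between r P') (hr : ρ + 2 * η ≤ r) (hs : ρ ≤ s) :
    ∃ Q', Y.Between ρ Q' ∧ P'.ghf Q' < η := by
  obtain ⟨g, hg, hc⟩ := hP'
  obtain ⟨S, hS, hSc⟩ := hg.exists_sub
  obtain ⟨ε, hε⟩ : ∃ ε : ℝ≥0, (ε : ℝ≥0∞) = P.ghf Q := ⟨_, ENNReal.coe_toNNReal hPQ.ne_top⟩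
  have hεη : ε ≤ η := by
    rw [← hε] at hPQ
    exact (ENNReal.coe_lt_coe.1 hPQ).le
  have h2 : ρ + 2 * ε ≤ r := le_trans (by gcongr) hr
  obtain ⟨S', hS', hS''⟩ := hsubBall P Q S ε r hε.symm (le_trans (by simp) h2) (hSc r hc)
  refine ⟨S'.toPair, (hQ.mono hs).comp ⟨_, S'.isSubVia, ?_⟩, ?_⟩
  · exact (Sub.coversVia hS').mono (le_tsub_of_add_le_right h2)
  · rw [MetFunctor.Pair.ghf_congr hS (MetFunctor.Pair.Iso.refl _)]
    exact hS''.trans_lt hPQ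

/-! ### The distance of tuples is a pseudo-metric -/

theorem approx_lt_iff {X Y : t.Tuple} {ε : ℝ≥0} {δ : ℝ≥0∞} :
    approx ε X Y < δ ↔
      ∃ P, Y.Between (1 / ε - ε) P ∧ (X.ball (1 / ε)).toPair.ghf P < δ := by
  simp only [approx, iInf_lt_iff]
  constructor
  · rintro ⟨S, hS, h⟩
    exact ⟨S.toPair, ⟨_, S.isSubVia, Sub.coversVia hS⟩, h⟩
  · rintro ⟨P, ⟨g, hg, hc⟩, h⟩
    obtain ⟨S, hS, hSc⟩ := hg.exists_sub
    refine ⟨S, hSc _ hc, ?_⟩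
    rwa [← MetFunctor.Pair.ghf_congr (MetFunctor.Pair.Iso.refl _) hS]

/-- The ball of radius `1 / (ε + δ)` is moved from `X` to `Y` and then to `Z`. With errors `ε / 2`
and `δ / 2`, the covered radius drops by `ε` and then by `δ`, exactly as the definition of `approx`
allows. -/
theorem approx_triangle (hsubBall : t.SubtupleApproxBall) {X Y Z : t.Tuple} {ε δ : ℝ≥0}
    (hε : 0 < ε) (hδ : 0 < δ) (hsum : ε + δ ≤ 1) (h1 : approx ε X Y < (ε : ℝ≥0∞) / 2)
    (h2 : approx δ Y Z < (δ : ℝ≥0∞) / 2) :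
    approx (ε + δ) X Z < ((ε + δ : ℝ≥0) : ℝ≥0∞) / 2 := by
  have hcoe : ∀ x : ℝ≥0, (x : ℝ≥0∞) / 2 = ((x / 2 : ℝ≥0) : ℝ≥0∞) := fun x => by simp
  rw [hcoe] at h1 h2 ⊢
  obtain ⟨P, hP, hXP⟩ := approx_lt_iff.1 h1
  obtain ⟨Q, hQ, hYQ⟩ := approx_lt_iff.1 h2
  have e1 : 1 / (ε + δ) + ε ≤ 1 / δ := by
    rw [← NNReal.coe_le_coe] at hsum ⊢
    rw [← NNReal.coe_pos] at hε hδ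
    push_cast at hsum ⊢
    rw [div_add' _ _ _ (by positivity), div_le_div_iff₀ (by positivity) hδ]
    nlinarith [mul_nonneg hε.le (mul_nonneg (by positivity : (0 : ℝ) ≤ ε + δ) hδ.le),
      mul_nonneg hε.le (by nlinarith : (0 : ℝ) ≤ 1 - (ε + δ) * δ)]
  have e2 : 1 / (ε + δ) + δ ≤ 1 / ε := by
    rw [← NNReal.coe_le_coe] at hsum ⊢
    rw [← NNReal.coe_pos] at hε hδ
    push_cast at hsum ⊢
    rw [div_add' _ _ _ (by positivity), div_le_div_iff₀ (by positivity) hε]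
    nlinarith [mul_nonneg hδ.le (mul_nonneg (by positivity : (0 : ℝ) ≤ ε + δ) hε.le),
      mul_nonneg hδ.le (by nlinarith : (0 : ℝ) ≤ 1 - (ε + δ) * ε)]
  have e3 : ε + δ ≤ 1 / (ε + δ) :=
    hsum.trans ((le_div_iff₀ (add_pos hε hδ)).2 (by simpa using hsum))
  have hε2 : 2 * (ε / 2) = ε := mul_div_cancel₀ ε two_ne_zero
  have hδ2 : 2 * (δ / 2) = δ := mul_div_cancel₀ δ two_ne_zero
  have hXX : (ofPair t (X.ball (1 / ε)).toPair).Between (1 / (ε + δ))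
      (X.ball (1 / (ε + δ))).toPair :=
    (X.between_ball_of_le (le_self_add.trans e2)).ball
  obtain ⟨P', hP', hXP'⟩ := hP.exists_near (ρ := 1 / (ε + δ) - ε) hsubBall hXP hXX
    (by rw [hε2, tsub_add_cancel_of_le (le_self_add.trans e3)])
    (tsub_le_tsub_right (le_self_add.trans e2) _)
  have hP'fit : (ofPair t (Y.ball (1 / δ)).toPair).Between (1 / (ε + δ) - ε) P' := by
    refine hP'.fit fun x => (((within_ball X _).of_ghf_lt hXP') x).trans ?_
    rw [hε2]
    exact NNReal.coe_le_coe.2 e1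
  obtain ⟨Q', hQ', hPQ'⟩ := hQ.exists_near (ρ := 1 / (ε + δ) - (ε + δ)) hsubBall hYQ hP'fit
    (by
      rw [hδ2]
      refine le_tsub_of_add_le_right ?_
      rw [add_assoc, add_comm δ, tsub_add_cancel_of_le e3])
    (tsub_le_tsub (le_self_add.trans e1) le_add_self)
  refine approx_lt_iff.2 ⟨Q', hQ', (MetFunctor.Pair.ghf_triangle _ P' _).trans_lt ?_⟩
  rw [add_div, ENNReal.coe_add]
  exact ENNReal.add_lt_add hXP' hPQ'

theorem approx_self (ε : ℝ≥0) (X : t.Tuple) : approx ε X X = 0 :=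
  bot_unique <| le_of_forall_gt fun _ h => approx_lt_iff.2
    ⟨_, X.between_ball_of_le tsub_le_self, by rwa [MetFunctor.Pair.ghf_self]⟩

theorem distance_le_one (X Y : t.Tuple) : distance X Y ≤ 1 :=
  csInf_le (OrderBot.bddBelow _) (mem_insert _ _)

theorem distance_le {X Y : t.Tuple} {ε : ℝ≥0} (hε : 0 < ε)
    (h : max (approx ε X Y) (approx ε Y X) < (ε : ℝ≥0∞) / 2) : distance X Y ≤ ε := by
  rcases le_total ε 1 with h1 | h1
  · exact csInf_le (OrderBot.bddBelow _) (Or.inr ⟨hε, h1, h⟩)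
  · exact (distance_le_one X Y).trans h1

theorem exists_of_distance_lt {X Y : t.Tuple} {ε : ℝ≥0} (h1 : ε ≤ 1) (h : distance X Y < ε) :
    ∃ δ, 0 < δ ∧ δ < ε ∧ max (approx δ X Y) (approx δ Y X) < (δ : ℝ≥0∞) / 2 := by
  obtain ⟨δ, rfl | ⟨h0, -, hδ⟩, hδε⟩ := exists_lt_of_csInf_lt (insert_nonempty _ _) h
  · exact absurd hδε h1.not_gt
  · exact ⟨δ, h0, hδε, hδ⟩

theorem distance_self (X : t.Tuple) : distance X X = 0 :=
  bot_unique <| le_of_forall_gt_imp_ge_of_dense fun ε hε => distance_le hε (by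
    rw [approx_self, max_self]
    exact ENNReal.half_pos (by simpa using hε.ne'))

theorem distance_comm (X Y : t.Tuple) : distance X Y = distance Y X := by
  simp only [distance, max_comm]

theorem distance_triangle (hsubBall : t.SubtupleApproxBall) (X Y Z : t.Tuple) :
    distance X Z ≤ distance X Y + distance Y Z := by
  refine le_of_forall_gt_imp_ge_of_dense fun c hc => ?_
  rcases le_or_gt 1 c with h1 | h1
  · exact (distance_le_one X Z).trans h1
  obtain ⟨κ, hκ, hκc⟩ : ∃ κ, 0 < κ ∧ distance X Y + κ + (distance Y Z + κ) = c := by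
    refine ⟨(c - (distance X Y + distance Y Z)) / 2, half_pos (tsub_pos_of_lt hc), ?_⟩
    have : ∀ a b x : ℝ≥0, a + x / 2 + (b + x / 2) = (a + b) + x := fun a b x => by
      rw [add_add_add_comm, add_halves]
    rw [this, add_tsub_cancel_of_le hc.le]
  obtain ⟨ε, hε, hεlt, hε'⟩ := exists_of_distance_lt (X := X) (Y := Y)
    ((le_self_add.trans hκc.le).trans h1.le) (lt_add_of_pos_right _ hκ)
  obtain ⟨δ, hδ, hδlt, hδ'⟩ := exists_of_distance_lt (X := Y) (Y := Z)
    ((le_add_self.trans hκc.le).trans h1.le) (lt_add_of_pos_right _ hκ)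
  have hlt : ε + δ < c := (add_lt_add hεlt hδlt).trans_eq hκc
  rw [max_lt_iff] at hε' hδ'
  refine le_trans (distance_le (add_pos hε hδ) (max_lt ?_ ?_)) hlt.le
  · exact approx_triangle hsubBall hε hδ (hlt.trans h1).le hε'.1 hδ'.1
  · rw [add_comm]
    exact approx_triangle hsubBall hδ hε (add_comm ε δ ▸ (hlt.trans h1).le) hδ'.2 hε'.2

end PosMetFunctor.Truncation.Tuple

namespace PosMetFunctor.Truncation.Tuple

variable {τ : PosMetFunctor.{u, v}} {t : τ.Truncation}

/-! ### Limits of subtuples -/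

theorem IsSubVia.map_le {P Q : τ.pointed.Pair} {g : Q.space → P.space}
    (h : (ofPair t P).IsSubVia Q g) :
    τ.map (X := Q.space) (Y := P.space) ⟨g, h.isometry⟩ Q.pt.2 ≤ P.pt.2 :=
  (τ.monotone_map _ (h.le.trans_eq (restr_ofPair P ⟨g, h.isometry⟩))).trans (t.map_tmap_le _ _)

/-- Carriers converge in the compact space of nonempty compact subsets of `P`, and the
pushed-forward elements converge in the compact cone below the element of `P`. -/
theorem exists_isSubVia_lim (hclosed : τ.HausdorffClosed) {ι : Type*} (V : Ultrafilter ι)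
    (P : τ.pointed.Pair) (R : ι → τ.pointed.Pair)
    (hR : ∀ i, ∃ g, (ofPair t P).IsSubVia (R i) g) :
    ∃ Q g, (ofPair t P).IsSubVia Q g ∧ ∀ ε : ℝ≥0∞, 0 < ε → ∀ᶠ i in V, Q.ghf (R i) < ε := by
  choose g hg using hR
  let f : ∀ i, (R i).space.Hom P.space := fun i => ⟨g i, (hg i).isometry⟩
  let K : ι → NonemptyCompacts P.space := fun i =>
    ⟨⟨range (f i), isCompact_range (f i).isometry.continuous⟩, ⟨_, mem_range_self (R i).pt.1⟩⟩
  obtain ⟨K₀, -, hK₀⟩ := isCompact_univ.ultrafilter_le_nhds (V.map K) (by simp)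
  obtain ⟨b, hb, hb'⟩ := (τ.isCompact_cone P.space P.pt.2).ultrafilter_le_nhds
    (V.map fun i => τ.map (f i) (R i).pt.2)
    (le_principal_iff.2 (Filter.mem_map.2 (univ_mem' fun i => (hg i).map_le)))
  have hH : ∀ ε : ℝ≥0∞, 0 < ε → ∀ᶠ i in V,
      Metric.hausdorffEDist (range (f i)) (K₀ : Set P.space) < ε := fun ε hε =>
    (EMetric.tendsto_nhds.1 (show Tendsto K V (𝓝 K₀) from hK₀) ε hε)
  have hE : ∀ ε : ℝ≥0∞, 0 < ε → ∀ᶠ i in V, edist (τ.map (f i) (R i).pt.2) b < ε := fun ε hε =>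
    EMetric.tendsto_nhds.1 (show Tendsto (fun i => τ.map (f i) (R i).pt.2) V (𝓝 b) from hb') ε hε
  have hpos : ∀ n : ℕ, (0 : ℝ≥0∞) < ((n : ℝ≥0∞) + 1)⁻¹ := fun n => by simp
  have hlim0 : Tendsto (fun n : ℕ => ((n : ℝ≥0∞) + 1)⁻¹) atTop (𝓝 0) := by
    have := (tendsto_add_atTop_iff_nat 1).2 ENNReal.tendsto_inv_nat_nhds_zero
    simpa using this
  -- Hausdorff-closedness speaks of sequences, so one is extracted along which both limits are
  -- reached.
  choose n hn using fun k : ℕ => ((hH _ (hpos k)).and (hE _ (hpos k))).exists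
  have hrange : range (CompMet.inclSpace K₀.toCompacts) = (K₀ : Set P.space) :=
    Subtype.range_coe
  obtain ⟨a, ha⟩ := hclosed P.space _ _ (CompMet.inclSpace K₀.toCompacts) (fun k => f (n k))
    (by
      rw [hrange]
      exact tendsto_of_tendsto_of_tendsto_of_le_of_le tendsto_const_nhds hlim0 (fun _ => bot_le)
        fun k => (hn k).1.le) b (fun k => (R (n k)).pt.2)
    (tendsto_iff_edist_tendsto_0.2 (tendsto_of_tendsto_of_tendsto_of_le_of_le tendsto_const_nhds
      hlim0 (fun _ => bot_le) fun k => (hn k).2.le))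
  have hfo : ∀ i, f i (R i).pt.1 = P.pt.1 := fun i => (hg i).map_o
  have ho : P.pt.1 ∈ K₀.toCompacts := by
    change P.pt.1 ∈ (K₀ : Set P.space)
    rw [← K₀.isCompact.isClosed.closure_eq]
    refine EMetric.mem_closure_iff.2 fun ε hε => ?_
    obtain ⟨i, hi⟩ := (hH ε hε).exists
    have hmem : P.pt.1 ∈ range (f i) := ⟨_, hfo i⟩
    exact Metric.exists_edist_lt_of_hausdorffEDist_lt hmem hi
  refine ⟨⟨CompMet.ofSet K₀.toCompacts, (⟨_, ho⟩, a)⟩, CompMet.inclSpace K₀.toCompacts,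
    ⟨isometry_subtype_coe, rfl, ?_⟩, fun ε hε => ?_⟩
  · refine le_trans ?_ (restr_ofPair P (CompMet.inclSpace K₀.toCompacts)).ge
    change a ≤ _
    rw [← t.tmap_map (CompMet.inclSpace K₀.toCompacts) a, ha]
    exact t.monotone_tmap _ hb
  · filter_upwards [hH ε hε, hE ε hε] with i h1 h2
    rw [MetFunctor.Pair.ghf_comm]
    refine MetFunctor.Pair.ghf_lt_iff.2 ⟨P.space, f i, CompMet.inclSpace K₀.toCompacts, ?_, ?_⟩
    · rwa [hrange]
    · refine max_lt ?_ ?_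
      · have : edist (f i (R i).pt.1) P.pt.1 = 0 := by rw [hfo, edist_self]
        exact this.trans_lt hε
      · change edist _ (τ.map _ a) < ε
        rwa [ha]

/-- The relation of being isomorphic to a subtuple is closed. -/
theorem exists_isSubVia_of_near (hcont : τ.PointwiseContinuous) (hsub : t.SubtupleApprox)
    (hclosed : τ.HausdorffClosed) {P Q : τ.pointed.Pair}
    (h : ∀ ε : ℝ≥0∞, 0 < ε → ∃ P' Q', P.ghf P' < ε ∧ Q.ghf Q' < ε ∧
      ∃ g, (ofPair t P').IsSubVia Q' g) :
    ∃ g, (ofPair t P).IsSubVia Q g := by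
  have h' : ∀ n : ℕ, ∃ R, Q.ghf R < 2 * ((n : ℝ≥0∞) + 1)⁻¹ ∧ ∃ g, (ofPair t P).IsSubVia R g := by
    intro n
    obtain ⟨P', Q', hP, hQ, g, hg⟩ := h ((n : ℝ≥0∞) + 1)⁻¹ (by simp)
    obtain ⟨R, f, hf, hR⟩ := exists_isSubVia_near hsub P hg
    refine ⟨R, (MetFunctor.Pair.ghf_triangle _ Q' _).trans_lt ?_, f, hf⟩
    rw [two_mul]
    refine ENNReal.add_lt_add hQ (hR.trans_lt ?_)
    rwa [MetFunctor.Pair.ghf_comm]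
  choose R hR hR' using h'
  obtain ⟨S, g, hg, hS⟩ := exists_isSubVia_lim hclosed (hyperfilter ℕ) P R hR'
  have hlim0 : Tendsto (fun n : ℕ => 2 * ((n : ℝ≥0∞) + 1)⁻¹) atTop (𝓝 0) := by
    have := (tendsto_add_atTop_iff_nat 1).2 ENNReal.tendsto_inv_nat_nhds_zero
    simpa using ENNReal.Tendsto.const_mul (a := 2) this (Or.inr (by simp))
  -- The subtuples `R n` of `P` approach `Q` as well as `S`, so these two are isomorphic.
  have h0 : Q.ghf S = 0 := by
    refine bot_unique (le_of_forall_gt fun ε hε => ?_)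
    have hε2 : 0 < ε / 2 := ENNReal.half_pos hε.ne'
    obtain ⟨n, h1, h2⟩ := ((hS _ hε2).and
      (Nat.hyperfilter_le_atTop (hlim0.eventually_lt_const hε2))).exists
    refine (MetFunctor.Pair.ghf_triangle _ (R n) _).trans_lt ?_
    rw [← ENNReal.add_halves ε]
    refine ENNReal.add_lt_add ((hR n).trans h2) ?_
    rwa [MetFunctor.Pair.ghf_comm]
  obtain ⟨e, he⟩ := MetFunctor.Pair.iso_of_ghf_eq_zero
    (MetFunctor.PointwiseContinuous.pointed hcont) h0
  refine ⟨_, hg.comp (f := e) ⟨e.isometry, congrArg Prod.fst he, ?_⟩⟩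
  have hmap : τ.map (CompMet.Hom.ofEquiv e) Q.pt.2 = S.pt.2 := congrArg Prod.snd he
  refine le_trans (le_of_eq ?_) (restr_ofPair S (CompMet.Hom.ofEquiv e)).ge
  rw [← hmap, t.tmap_map]

/-- If `P` is a subtuple of `Y` and `Y^(r)` is isomorphic to a subtuple of `P`, then
`Y^(r) ⪯ P`. -/
theorem IsSubVia.coversVia (hrigid : τ.Rigid) {Y : t.Tuple} {P : τ.pointed.Pair}
    {g : P.space → Y.space} (hg : Y.IsSubVia P g) {r : ℝ≥0}
    {j : (Y.ball r).toPair.space → P.space} (hj : (ofPair t P).IsSubVia (Y.ball r).toPair j) :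
    Y.CoversVia P g r := by
  have hgj := hg.comp hj
  have hmem : ∀ x, g (j x) ∈ (Y.ball r).carrier := fun x => by
    change dist _ _ ≤ _
    rw [← hgj.map_o]
    exact (hgj.isometry.dist_eq _ _).trans_le x.2
  let B := CompMet.ofSet (Y.ball r).carrier
  -- The composite is an isometric self-embedding of the compact ball, hence onto, and rigidity
  -- shows that it fixes the element `c`.
  let ψ : B.Hom B := ⟨fun x => ⟨g (j x), hmem x⟩, hgj.isometry⟩
  let E : B ≃ᵢ B := ⟨Equiv.ofBijective ψ
    ⟨ψ.isometry.injective, ψ.isometry.surjective_of_compactSpace⟩, ψ.isometry⟩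
  set c := Y.a.val (Y.ball r).carrier with hc
  have h1 : c ≤ t.tmap ψ c := hgj.le.trans_eq (restr_eq Y hgj.isometry _ hmem)
  have h2 : τ.map (CompMet.Hom.ofEquiv E) c = c :=
    hrigid B E c ((τ.monotone_map _ h1).trans (t.map_tmap_le _ _))
  have h3 : t.tmap (CompMet.Hom.ofEquiv E.symm) c = c := by
    have : τ.map (CompMet.Hom.ofEquiv E.symm) (τ.map (CompMet.Hom.ofEquiv E) c) = c := by
      rw [← τ.map_comp]
      convert τ.map_id B c using 2
      exact CompMet.Hom.ext fun x => E.symm_apply_apply x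
    rw [h2] at this
    conv_lhs => rw [← this]
    exact t.tmap_map _ _
  -- The map `j` is a section of `g` only up to `E`; composing with `E.symm` corrects this.
  refine ⟨CompMet.Hom.comp ⟨j, hj.isometry⟩ (CompMet.Hom.ofEquiv E.symm), fun x => ?_, ?_⟩
  · exact congrArg Subtype.val (E.apply_symm_apply x)
  · rw [t.tmap_comp]
    refine h3.symm.trans_le (t.monotone_tmap _ ?_)
    exact hj.le.trans_eq (restr_ofPair P ⟨j, hj.isometry⟩)

/-! ### Exhaustions by compact pairs -/

/-- An exhaustion of a pointed metric space by compact pairs, each of which contains a truncated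
ball of the following one. -/
structure Exhaustion (t : τ.Truncation) (X : Type u) [MetricSpace X] (o : X) where
  pair : ℕ → τ.pointed.Pair
  map : ∀ k, (pair k).space → X
  isometry : ∀ k, Isometry (map k)
  map_o : ∀ k, map k (pair k).pt.1 = o
  step : ∀ k, (pair k).space.Hom (pair (k + 1)).space
  map_step : ∀ k x, map (k + 1) (step k x) = map k x
  le_step : ∀ k, (pair k).pt.2 ≤ t.tmap (step k) (pair (k + 1)).pt.2
  covers : ∀ k : ℕ, (ofPair t (pair (k + 1))).CoversVia (pair k) (step k) k
  exists_map_eq : ∀ x, ∃ k y, map k y = x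

namespace Exhaustion

variable {X : Type u} [MetricSpace X] {o : X} (E : Exhaustion t X o)

theorem range_mono : Monotone fun k => range (E.map k) :=
  monotone_nat_of_le_succ fun k => by
    rintro _ ⟨x, rfl⟩
    exact ⟨_, E.map_step k x⟩

/-- A point within `k` of `o` that appears at stage `k + d + 1` lies in the ball which stage `k + d`
covers, so it descends to stage `k`. -/
theorem closedBall_subset (k : ℕ) : Metric.closedBall o k ⊆ range (E.map k) := by
  intro x hx
  obtain ⟨m, hm⟩ := E.exists_map_eq x
  have hd : ∀ d, x ∈ range (E.map (k + d)) → x ∈ range (E.map k) := by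
    intro d
    induction d with
    | zero => exact id
    | succ d ih =>
      rintro ⟨y, hy⟩
      obtain ⟨s, hs, -⟩ := E.covers (k + d)
      have hy' : dist y (E.pair (k + d + 1)).pt.1 ≤ ((k + d : ℕ) : ℝ≥0) := by
        refine ((E.isometry (k + d + 1)).dist_eq y (E.pair (k + d + 1)).pt.1).symm.trans_le ?_
        refine (show dist (E.map (k + d + 1) y) _ ≤ k from ?_).trans ?_
        · rw [E.map_o (k + d + 1)]
          exact hy ▸ hx
        push_cast
        exact le_add_of_nonneg_right (Nat.cast_nonneg d)
      refine ih ⟨s ⟨y, hy'⟩, ?_⟩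
      rw [← E.map_step]
      exact (congrArg (E.map (k + d + 1)) (hs ⟨y, hy'⟩)).trans hy
  exact hd m (E.range_mono (Nat.le_add_left m k) hm)

theorem properSpace {X : Type u} [MetricSpace X] {o : X} (E : Exhaustion t X o) :
    ProperSpace X := by
  refine ⟨fun x r => ?_⟩
  obtain ⟨k, hk⟩ := exists_nat_ge (r + dist x o)
  refine (isCompact_range (E.isometry k).continuous).of_isClosed_subset
    Metric.isClosed_closedBall fun y hy => E.closedBall_subset k ?_
  rw [Metric.mem_closedBall] at hy ⊢
  linarith [dist_triangle y x o]

/-- An isometric embedding into the `k`-th pair which lifts the map `g`. -/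
structure Lift {C : CompMet.{u}} (g : C → X) (k : ℕ) where
  hom : C.Hom (E.pair k).space
  map_hom : ∀ c, E.map k (hom c) = g c

theorem exists_lift {C : CompMet.{u}} {g : C → X} (hg : Isometry g) {k : ℕ}
    (h : ∀ c, g c ∈ range (E.map k)) : Nonempty (E.Lift g k) := by
  choose f hf using h
  refine ⟨⟨⟨f, fun x y => ?_⟩, hf⟩⟩
  rw [← (E.isometry k).edist_eq, hf, hf, hg.edist_eq]

variable {E} {C : CompMet.{u}} {g : C → X}

/-- The truncation of the element of the `k`-th pair along a lift. -/
def Lift.elt {k : ℕ} (f : E.Lift g k) : τ.obj C :=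
  t.tmap f.hom (E.pair k).pt.2

/-- A lift to the next pair. -/
def Lift.succ {k : ℕ} (f : E.Lift g k) : E.Lift g (k + 1) :=
  ⟨(E.step k).comp f.hom, fun c => (E.map_step k _).trans (f.map_hom c)⟩

theorem Lift.unique {k : ℕ} (f f' : E.Lift g k) : f = f' := by
  obtain ⟨f, hf⟩ := f
  obtain ⟨f', hf'⟩ := f'
  obtain rfl : f = f' := CompMet.Hom.ext fun c =>
    (E.isometry k).injective ((hf c).trans (hf' c).symm)
  rfl

theorem Lift.elt_le_succ {k : ℕ} (f : E.Lift g k) : f.elt ≤ f.succ.elt :=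
  (t.monotone_tmap _ (E.le_step k)).trans_eq (t.tmap_comp _ _ _).symm

/-- Elements grow along the chain, and covering gives the reverse inequality inside radius `k`.
Truncations to a bounded set thus stabilize, which makes the limit family well defined. -/
theorem Lift.elt_succ {k : ℕ} (f : E.Lift g k) (h : ∀ c, dist (g c) o ≤ k) :
    f.succ.elt = f.elt := by
  refine le_antisymm ?_ f.elt_le_succ
  obtain ⟨s, hs, hs'⟩ := E.covers k
  have hmem : ∀ c, dist (f.succ.hom c) (E.pair (k + 1)).pt.1 ≤ (k : ℝ≥0) := fun c => by
    rw [← (E.isometry _).dist_eq, E.map_o, f.succ.map_hom]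
    exact h c
  let q : C.Hom (CompMet.ofSet ((ofPair t (E.pair (k + 1))).ball k).carrier) :=
    ⟨fun c => ⟨f.succ.hom c, hmem c⟩, f.succ.hom.isometry⟩
  have hq : s.comp q = f.hom := CompMet.Hom.ext fun c =>
    (E.step k).isometry.injective (hs (q c))
  have h1 : f.succ.elt = t.tmap q (t.tmap (CompMet.inclSpace (X := (E.pair (k + 1)).space)
      ((ofPair t (E.pair (k + 1))).ball k).carrier) (E.pair (k + 1)).pt.2) :=
    t.tmap_comp (CompMet.inclSpace (X := (E.pair (k + 1)).space)
      ((ofPair t (E.pair (k + 1))).ball k).carrier) q _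
  rw [h1, Lift.elt, ← hq, t.tmap_comp]
  exact t.monotone_tmap _ hs'

theorem Lift.elt_le {k m : ℕ} (hkm : k ≤ m) (f : E.Lift g k) (f' : E.Lift g m) :
    f.elt ≤ f'.elt := by
  induction m, hkm using Nat.le_induction with
  | base => rw [f.unique f']
  | succ m hkm ih =>
    obtain ⟨f₁⟩ : Nonempty (E.Lift g m) := by
      have hg : Isometry g := by
        rw [← funext f.map_hom]
        exact (E.isometry k).comp f.hom.isometry
      exact E.exists_lift hg fun c => E.range_mono hkm ⟨_, f.map_hom c⟩
    rw [f'.unique f₁.succ]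
    exact (ih f₁).trans f₁.elt_le_succ

theorem Lift.elt_eq_of_le {k m : ℕ} (hkm : k ≤ m) (f : E.Lift g k) (f' : E.Lift g m)
    (h : ∀ c, dist (g c) o ≤ k) : f.elt = f'.elt := by
  induction m, hkm using Nat.le_induction with
  | base => rw [f.unique f']
  | succ m hkm ih =>
    obtain ⟨f₁⟩ : Nonempty (E.Lift g m) := by
      have hg : Isometry g := by
        rw [← funext f.map_hom]
        exact (E.isometry k).comp f.hom.isometry
      exact E.exists_lift hg fun c => E.range_mono hkm ⟨_, f.map_hom c⟩
    rw [f'.unique f₁.succ, f₁.elt_succ fun c => (h c).trans (Nat.cast_le.2 hkm)]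
    exact ih f₁

theorem Lift.elt_eq {k m : ℕ} (f : E.Lift g k) (f' : E.Lift g m)
    (h : ∀ c, dist (g c) o ≤ k) (h' : ∀ c, dist (g c) o ≤ m) : f.elt = f'.elt := by
  rcases le_total k m with hkm | hkm
  · exact f.elt_eq_of_le hkm f' h
  · exact (f'.elt_eq_of_le hkm f h').symm

/-- Precomposition of a lift. -/
def Lift.comp {k : ℕ} (f : E.Lift g k) {D : CompMet.{u}} (p : D.Hom C) :
    E.Lift (fun x => g (p x)) k :=
  ⟨f.hom.comp p, fun x => f.map_hom (p x)⟩

theorem Lift.elt_comp {k : ℕ} (f : E.Lift g k) {D : CompMet.{u}} (p : D.Hom C) :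
    (f.comp p).elt = t.tmap p f.elt :=
  t.tmap_comp _ _ _

variable (E)

theorem exists_lift_compacts (Y : Compacts X) :
    ∃ k : ℕ, (∀ y : CompMet.ofSet Y, dist y.1 o ≤ k) ∧
      Nonempty (E.Lift (C := CompMet.ofSet Y) Subtype.val k) := by
  obtain ⟨r, hr⟩ := Y.isCompact.isBounded.subset_closedBall o
  obtain ⟨k, hk⟩ := exists_nat_ge r
  have h : ∀ y : CompMet.ofSet Y, dist y.1 o ≤ k := fun y =>
    (Metric.mem_closedBall.1 (hr y.2)).trans hk
  exact ⟨k, h, E.exists_lift isometry_subtype_coe fun y => E.closedBall_subset k (h y)⟩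

/-- The compatible family determined by an exhaustion. -/
noncomputable def ext : t.Ext X where
  val Y := (E.exists_lift_compacts Y).choose_spec.2.some.elt
  compat {Y Y'} h := by
    refine (Lift.elt_comp _ (CompMet.incl h)).symm.trans ?_
    exact Lift.elt_eq _ _ (fun c => (E.exists_lift_compacts Y').choose_spec.1 (CompMet.incl h c))
      (E.exists_lift_compacts Y).choose_spec.1

theorem ext_val (Y : Compacts X) : ∃ (k : ℕ) (f : E.Lift (C := CompMet.ofSet Y) Subtype.val k),
    (∀ y : CompMet.ofSet Y, dist y.1 o ≤ k) ∧ E.ext.val Y = f.elt :=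
  ⟨_, _, (E.exists_lift_compacts Y).choose_spec.1, rfl⟩

/-- The tuple determined by an exhaustion. -/
noncomputable def tuple : t.Tuple where
  space := X
  proper := E.properSpace
  o := o
  a := E.ext

theorem between_tuple (k : ℕ) : E.tuple.Between k (E.pair k) := by
  let f₀ : E.Lift (E.map k) k := ⟨CompMet.Hom.id _, fun _ => rfl⟩
  have hf₀ : f₀.elt = (E.pair k).pt.2 := t.tmap_id _ _
  refine ⟨E.map k, ⟨E.isometry k, E.map_o k, ?_⟩, ?_⟩
  · let K : Compacts X := ⟨range (E.map k), isCompact_range (E.isometry k).continuous⟩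
    obtain ⟨m, f, hm, hf⟩ := E.ext_val K
    let p : (E.pair k).space.Hom (CompMet.ofSet K) :=
      ⟨fun x => ⟨E.map k x, mem_range_self x⟩, E.isometry k⟩
    have h1 : E.tuple.restr (E.map k) (E.isometry k) = (f.comp p).elt := by
      rw [f.elt_comp p, ← hf]
      rfl
    rw [h1, ← hf₀]
    -- The pair at stage `k` may reach beyond radius `k`, so passing to a later stage `m` gives only
    -- an inequality; if `m ≤ k`, the elements have already stabilized.
    rcases le_total k m with hkm | hkm
    · exact f₀.elt_le hkm (f.comp p)
    · exact ((f.comp p).elt_eq_of_le hkm f₀ fun c => hm (p c)).ge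
  · obtain ⟨m, f, hm, hf⟩ := E.ext_val (E.tuple.ball k).carrier
    have hk : ∀ y : CompMet.ofSet (E.tuple.ball k).carrier, dist y.1 o ≤ k := fun y => y.2
    obtain ⟨f'⟩ := E.exists_lift (C := CompMet.ofSet (E.tuple.ball k).carrier) (k := k)
      (g := Subtype.val) isometry_subtype_coe (fun y => E.closedBall_subset k (hk y))
    exact ⟨f'.hom, f'.map_hom, (hf.trans (f.elt_eq f' hm hk)).le⟩

end Exhaustion

/-- The direct limit of a chain of pairs, each of which contains a truncated ball of the next. -/
theorem exists_tuple_of_chain (L : ℕ → τ.pointed.Pair)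
    (e : ∀ k, (L k).space → (L (k + 1)).space)
    (he : ∀ k, (ofPair t (L (k + 1))).IsSubVia (L k) (e k))
    (hc : ∀ k : ℕ, (ofPair t (L (k + 1))).CoversVia (L k) (e k) k) :
    ∃ X : t.Tuple, ∀ k : ℕ, X.Between k (L k) := by
  have I : ∀ k, Isometry (e k) := fun k => (he k).isometry
  have hcomm : ∀ k x, Metric.toInductiveLimit I (k + 1) (e k x) = Metric.toInductiveLimit I k x :=
    fun k x => congrFun (Metric.toInductiveLimit_commute I k) x
  let E : Exhaustion t (Metric.InductiveLimit I) (Metric.toInductiveLimit I 0 (L 0).pt.1) :=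
    { pair := L
      map := fun k => Metric.toInductiveLimit I k
      isometry := fun k => Metric.toInductiveLimit_isometry I k
      map_o := fun k => by
        induction k with
        | zero => rfl
        | succ k ih =>
          rw [← ih, ← hcomm k]
          exact congrArg _ (he k).map_o.symm
      step := fun k => ⟨e k, I k⟩
      map_step := hcomm
      le_step := fun k => (he k).le.trans_eq (restr_ofPair (L (k + 1)) ⟨e k, I k⟩)
      covers := hc
      -- The inductive limit is a quotient of the disjoint union of the stages, without completion.
      exists_map_eq := fun x => by
        obtain ⟨⟨k, y⟩, rfl⟩ := Quotient.exists_rep x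
        exact ⟨k, y, rfl⟩ }
  exact ⟨E.tuple, E.between_tuple⟩

end PosMetFunctor.Truncation.Tuple

namespace PosMetFunctor.Truncation

variable {τ : PosMetFunctor.{u, v}} {t : τ.Truncation}

/-! ### Limits of tuples with convergent truncated balls -/

namespace Tuple

/-- Both inclusions pass to the limit from the balls of one tuple. Balls of radius `k + 1` are used
to cover radius `k`, since approximation enlarges radii. -/
theorem exists_chain_of_tendsto_ball (hrigid : τ.Rigid) (hcont : τ.PointwiseContinuous)
    (hsub : t.SubtupleApprox) (hclosed : τ.HausdorffClosed) {l : Filter t.Tuple} [l.NeBot]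
    {L L' : τ.pointed.Pair} (k : ℕ)
    (hL : ∀ ε : ℝ≥0∞, 0 < ε → ∀ᶠ X in l, L.ghf (X.ball (k + 1)).toPair < ε)
    (hL' : ∀ ε : ℝ≥0∞, 0 < ε → ∀ᶠ X in l, L'.ghf (X.ball (k + 1 + 1)).toPair < ε) :
    ∃ e, (ofPair t L').IsSubVia L e ∧ (ofPair t L').CoversVia L e k := by
  obtain ⟨e, he⟩ : ∃ e, (ofPair t L').IsSubVia L e := by
    refine exists_isSubVia_of_near hcont hsub hclosed fun ε hε => ?_
    obtain ⟨X, h1, h2⟩ := ((hL ε hε).and (hL' ε hε)).exists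
    obtain ⟨g, hg, -⟩ := ((within_ball X (k + 1)).mono (le_self_add (b := 1))).exists_fit
      (X.ball (k + 1)).isSubVia
    exact ⟨_, _, h2, h1, g, hg⟩
  obtain ⟨j, hj⟩ : ∃ j, (ofPair t L).IsSubVia ((ofPair t L').ball k).toPair j := by
    refine exists_isSubVia_of_near hcont hsub hclosed fun ε hε => ?_
    -- An error below `1 / 2` enlarges the radius `k` by at most `1`, so the copy still fits in the
    -- ball of radius `k + 1`.
    have hε' : 0 < min ε ((1 / 2 : ℝ≥0) : ℝ≥0∞) := lt_min hε (by simp)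
    obtain ⟨X, h1, h2⟩ := ((hL ε hε).and (hL' _ hε')).exists
    obtain ⟨Q, g, hg, hQ⟩ := exists_isSubVia_near hsub (X.ball (k + 1 + 1)).toPair
      (((ofPair t L').ball k).isSubVia)
    have hQ' := hQ.trans_lt h2
    have hw : Within Q (k + 1) := by
      have := (within_ball (ofPair t L') k).of_ghf_lt (hQ'.trans_le (min_le_right _ _))
      rwa [mul_one_div_cancel two_ne_zero] at this
    obtain ⟨g', hg', -⟩ := hw.exists_fit ((X.ball (k + 1 + 1)).isSubVia.comp hg)
    exact ⟨_, Q, h1, hQ'.trans_le (min_le_left _ _), g', hg'⟩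
  exact ⟨e, he, he.coversVia hrigid hj⟩

theorem exists_lim_of_tendsto_ball (hrigid : τ.Rigid) (hcont : τ.PointwiseContinuous)
    (hsub : t.SubtupleApprox) (hsubBall : t.SubtupleApproxBall) (hclosed : τ.HausdorffClosed)
    {l : Filter t.Tuple} [l.NeBot] (L : ℕ → τ.pointed.Pair)
    (hL : ∀ (k : ℕ) (ε : ℝ≥0∞), 0 < ε → ∀ᶠ X in l, (L k).ghf (X.ball (k + 1)).toPair < ε) :
    ∃ X : t.Tuple, ∀ ε : ℝ≥0, 0 < ε → ∀ᶠ Y in l, distance X Y ≤ ε := by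
  choose e he hc using fun k : ℕ =>
    exists_chain_of_tendsto_ball hrigid hcont hsub hclosed k (hL k)
      (by simpa using hL (k + 1))
  obtain ⟨X, hX⟩ := exists_tuple_of_chain L e he hc
  refine ⟨X, fun ε hε => ?_⟩
  wlog hε1 : ε ≤ 1 generalizing ε
  · exact .of_forall fun Y => (distance_le_one X Y).trans (not_le.1 hε1).le
  -- At this stage `L k` contains the ball of radius `1 / ε` of `X`. Closeness of `L k` to a ball of
  -- `Y` then allows balls to be moved in both directions.
  obtain ⟨k, hk⟩ := exists_nat_ge (1 / ε)
  have hε' : (0 : ℝ≥0∞) < ((ε / 2 : ℝ≥0) : ℝ≥0∞) := ENNReal.coe_pos.2 (half_pos hε)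
  have hle : ε ≤ 1 / ε :=
    hε1.trans ((le_div_iff₀ hε).2 (by simpa using hε1))
  have hρ : 1 / ε - ε + 2 * (ε / 2) ≤ 1 / ε := by
    rw [mul_div_cancel₀ ε two_ne_zero, tsub_add_cancel_of_le hle]
  filter_upwards [hL k _ hε'] with Y hY
  refine distance_le hε ?_
  rw [show (ε : ℝ≥0∞) / 2 = ((ε / 2 : ℝ≥0) : ℝ≥0∞) by simp]
  refine max_lt (approx_lt_iff.2 ?_) (approx_lt_iff.2 ?_)
  · exact (Y.between_ball_of_le (le_refl ((k : ℝ≥0) + 1))).exists_near hsubBall hY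
      ((hX k).mono hk).ball hρ (tsub_le_self.trans (hk.trans le_self_add))
  · rw [MetFunctor.Pair.ghf_comm] at hY
    exact (hX k).exists_near hsubBall hY
      (Y.between_ball_of_le (hk.trans le_self_add)).ball hρ (tsub_le_self.trans hk)

/-- A truncated ball of a tuple near `X` is close to some subtuple of a truncated ball of `X`. -/
theorem exists_isSubVia_ball_of_distance_lt (hsub : t.SubtupleApprox) {X Y : t.Tuple}
    {r ε : ℝ≥0} (hε : ε ≤ 1 / (r + 1)) (h : distance X Y < ε) :
    ∃ Q, (∃ g, (ofPair t (X.ball (r + 1)).toPair).IsSubVia Q g) ∧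
      (Y.ball r).toPair.ghf Q < ε := by
  have hε1 : ε ≤ 1 := hε.trans (div_le_one_of_le₀ le_add_self zero_le)
  obtain ⟨δ, hδ, hδε, hδ'⟩ := exists_of_distance_lt hε1 h
  obtain ⟨P, ⟨g, hg, -⟩, hP⟩ := approx_lt_iff.1 ((le_max_right _ _).trans_lt hδ')
  -- The bound on `ε` serves twice: the compared ball of `Y` contains its `r`-ball, and radii grow
  -- by at most `1`.
  have hr : r ≤ 1 / δ := by
    rw [le_div_iff₀ hδ]
    rw [le_div_iff₀ (by positivity)] at hε
    calc r * δ ≤ δ * (r + 1) := by rw [mul_comm]; gcongr; exact le_self_add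
      _ ≤ ε * (r + 1) := by gcongr
      _ ≤ 1 := hε
  obtain ⟨f, hf, -⟩ := (Y.between_ball_of_le hr).ball
  obtain ⟨Q, g', hg', hQ⟩ := exists_isSubVia_near hsub P hf
  have hQδ : (Y.ball r).toPair.ghf Q < ((δ / 2 : ℝ≥0) : ℝ≥0∞) := by
    refine (hQ.trans_lt hP).trans_eq ?_
    simp
  have hw : Within Q (r + 1) := fun x => by
    refine ((within_ball Y r).of_ghf_lt hQδ x).trans (NNReal.coe_le_coe.2 ?_)
    rw [mul_div_cancel₀ δ two_ne_zero]
    exact add_le_add_right (hδε.le.trans hε1) _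
  obtain ⟨q, hq, -⟩ := hw.exists_fit (hg.comp hg')
  refine ⟨Q, ⟨q, hq⟩, hQδ.trans_le (ENNReal.coe_le_coe.2 ?_)⟩
  exact (half_le_self zero_le).trans hδε.le

end Tuple

/-! ### Relative compactness -/

theorem classes_ghf_self (c : τ.pointed.Classes) : c.ghf c = 0 :=
  Quotient.inductionOn c MetFunctor.Pair.ghf_self

theorem classes_ghf_comm (c c' : τ.pointed.Classes) : c.ghf c' = c'.ghf c :=
  Quotient.inductionOn₂ c c' MetFunctor.Pair.ghf_comm

theorem classes_ghf_triangle (c c' c'' : τ.pointed.Classes) :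
    c.ghf c'' ≤ c.ghf c' + c'.ghf c'' :=
  Quotient.inductionOn₃ c c' c'' fun P Q R => MetFunctor.Pair.ghf_triangle P Q R

theorem isRelCompactDist_ghf_iff {A : Set τ.pointed.Classes} :
    IsRelCompactDist MetFunctor.Classes.ghf A ↔ ∀ U : Ultrafilter τ.pointed.Classes, A ∈ U →
      ∃ x : τ.pointed.Classes, ∀ ε : ℝ≥0∞, 0 < ε → ∀ᶠ y in U, x.ghf y < ε :=
  isRelCompactDist_iff classes_ghf_self classes_ghf_comm classes_ghf_triangle

theorem isRelCompactDist_distance_iff (hsubBall : t.SubtupleApproxBall) {A : Set t.Classes} :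
    IsRelCompactDist (fun x y : t.Classes => (x.distance y : ℝ≥0∞)) A ↔
      ∀ U : Ultrafilter t.Classes, A ∈ U →
        ∃ x : t.Classes, ∀ ε : ℝ≥0∞, 0 < ε → ∀ᶠ y in U, (x.distance y : ℝ≥0∞) < ε := by
  refine isRelCompactDist_iff ?_ ?_ ?_
  · exact fun x => Quotient.inductionOn x fun X => congrArg _ (Tuple.distance_self X)
  · exact fun x y => Quotient.inductionOn₂ x y fun X Y => congrArg _ (Tuple.distance_comm X Y)
  · refine fun x y z => Quotient.inductionOn₃ x y z fun X Y Z => ?_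
    rw [← ENNReal.coe_add]
    exact ENNReal.coe_le_coe.2 (Tuple.distance_triangle hsubBall X Y Z)

theorem exists_lim_of_isSubVia (hclosed : τ.HausdorffClosed) (P : τ.pointed.Pair)
    (V : Ultrafilter τ.pointed.Classes)
    (hV : {c | ∃ Q g, (Tuple.ofPair t P).IsSubVia Q g ∧ Quotient.mk _ Q = c} ∈ V) :
    ∃ x : τ.pointed.Classes, ∀ ε : ℝ≥0∞, 0 < ε → ∀ᶠ y in V, x.ghf y < ε := by
  have hne : Nonempty {Q : τ.pointed.Pair // ∃ g, (Tuple.ofPair t P).IsSubVia Q g} := by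
    obtain ⟨_, Q, g, hg, -⟩ := V.nonempty_of_mem hV
    exact ⟨⟨Q, g, hg⟩⟩
  have hex : ∀ c : τ.pointed.Classes,
      ∃ R : {Q : τ.pointed.Pair // ∃ g, (Tuple.ofPair t P).IsSubVia Q g},
        c ∈ {c | ∃ Q g, (Tuple.ofPair t P).IsSubVia Q g ∧ Quotient.mk _ Q = c} →
          Quotient.mk _ R.1 = c := by
    intro c
    by_cases hc : c ∈ {c | ∃ Q g, (Tuple.ofPair t P).IsSubVia Q g ∧ Quotient.mk _ Q = c}
    · obtain ⟨Q, g, hg, hQ⟩ := hc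
      exact ⟨⟨Q, g, hg⟩, fun _ => hQ⟩
    · exact ⟨hne.some, fun h => absurd h hc⟩
  choose R hR using hex
  obtain ⟨Q, -, -, hQ⟩ := Tuple.exists_isSubVia_lim hclosed V P (fun c => (R c).1)
    fun c => (R c).2
  refine ⟨Quotient.mk _ Q, fun ε hε => ?_⟩
  filter_upwards [hQ ε hε, hV] with c h1 h2
  rw [← hR c h2]
  exact h1

theorem isRelCompactDist_ballClasses (hsub : t.SubtupleApprox)
    (hsubBall : t.SubtupleApproxBall) (hclosed : τ.HausdorffClosed) {A : Set t.Classes}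
    (hA : IsRelCompactDist (fun x y : t.Classes => (x.distance y : ℝ≥0∞)) A) (r : ℝ≥0) :
    IsRelCompactDist (MetFunctor.Classes.ghf (F := τ.pointed)) (ballClasses A r) := by
  rw [isRelCompactDist_distance_iff hsubBall] at hA
  refine isRelCompactDist_ghf_iff.2 fun U hU => ?_
  have hex : ∀ c : τ.pointed.Classes, ∃ X : t.Tuple,
      c ∈ ballClasses A r → X.toClass ∈ A ∧ (X.ball r).toClass = c := by
    intro c
    by_cases hc : c ∈ ballClasses A r
    · exact hc.imp fun X hX _ => hX
    · obtain ⟨_, X, -⟩ := U.nonempty_of_mem hU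
      exact ⟨X, fun h => absurd h hc⟩
  choose σ hσ using hex
  obtain ⟨x, hx⟩ := hA (U.map fun c => (σ c).toClass)
    (Ultrafilter.mem_map.2 (mem_of_superset hU fun c hc => (hσ c hc).1))
  obtain ⟨X, rfl⟩ := Quotient.exists_rep x
  -- The limit is sought among the subtuples of `X^(r+1)`; it is not claimed to be the `r`-ball of
  -- `X`.
  refine exists_lim_of_forall_near classes_ghf_self classes_ghf_comm classes_ghf_triangle
    (exists_lim_of_isSubVia (t := t) hclosed (X.ball (r + 1)).toPair) U fun ε hε => ?_
  obtain ⟨δ, hδ0, hδ⟩ := ENNReal.lt_iff_exists_nnreal_btwn.1 hε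
  set κ := min δ (1 / (r + 1)) with hκ
  have hκ0 : (0 : ℝ≥0∞) < κ :=
    ENNReal.coe_pos.2 (lt_min (ENNReal.coe_pos.1 hδ0) (by positivity))
  have hx' : ∀ᶠ c in U, (X.toClass.distance (σ c).toClass : ℝ≥0∞) < κ := hx κ hκ0
  filter_upwards [hx', hU] with c hc hcU
  obtain ⟨Q, ⟨g, hg⟩, hQ⟩ := Tuple.exists_isSubVia_ball_of_distance_lt hsub (X := X) (Y := σ c)
    (min_le_right δ _) (ENNReal.coe_lt_coe.1 hc)
  refine ⟨Quotient.mk _ Q, ⟨Q, g, hg, rfl⟩, ?_⟩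
  rw [← (hσ c hcU).2]
  exact hQ.trans ((ENNReal.coe_le_coe.2 (min_le_left _ _)).trans_lt hδ)

theorem isRelCompactDist_of_ballClasses (hrigid : τ.Rigid) (hcont : τ.PointwiseContinuous)
    (hsub : t.SubtupleApprox) (hsubBall : t.SubtupleApproxBall) (hclosed : τ.HausdorffClosed)
    {A : Set t.Classes}
    (hA : ∀ r : ℝ≥0, IsRelCompactDist (MetFunctor.Classes.ghf (F := τ.pointed))
      (ballClasses A r)) :
    IsRelCompactDist (fun x y : t.Classes => (x.distance y : ℝ≥0∞)) A := by
  refine (isRelCompactDist_distance_iff hsubBall).2 fun U hU => ?_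
  obtain ⟨out, hout⟩ : ∃ out : t.Classes → t.Tuple, ∀ c, (out c).toClass = c :=
    ⟨Quotient.out, Quotient.out_eq⟩
  have hlim : ∀ k : ℕ, ∃ L : τ.pointed.Pair, ∀ ε : ℝ≥0∞, 0 < ε → ∀ᶠ c in U,
      L.ghf ((out c).ball (k + 1)).toPair < ε := by
    intro k
    obtain ⟨x, hx⟩ := isRelCompactDist_ghf_iff.1 (hA (k + 1))
      (U.map fun c => ((out c).ball (k + 1)).toClass)
      (Ultrafilter.mem_map.2 (mem_of_superset hU fun c hc => ⟨out c, (hout c).symm ▸ hc, rfl⟩))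
    obtain ⟨L, rfl⟩ := Quotient.exists_rep x
    exact ⟨L, hx⟩
  choose L hL using hlim
  obtain ⟨X, hX⟩ := Tuple.exists_lim_of_tendsto_ball hrigid hcont hsub hsubBall hclosed
    (l := map out (U : Filter t.Classes)) L fun k ε hε => hL k ε hε
  refine ⟨X.toClass, fun ε hε => ?_⟩
  obtain ⟨δ, hδ0, hδ⟩ := ENNReal.lt_iff_exists_nnreal_btwn.1 hε
  have hX' : ∀ᶠ c in U, Tuple.distance X (out c) ≤ δ := hX δ (ENNReal.coe_pos.1 hδ0)
  filter_upwards [hX'] with c hc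
  rw [← hout c]
  exact (ENNReal.coe_le_coe.2 hc).trans_lt hδ

end PosMetFunctor.Truncation

theorem theorem4p6 (τ : PosMetFunctor.{u, v}) (t : τ.Truncation)
    (hrigid : τ.Rigid) (hcont : τ.PointwiseContinuous)
    (hsub : t.SubtupleApprox) (hsubBall : t.SubtupleApproxBall) (hclosed : τ.HausdorffClosed)
    (A : Set t.Classes) :
    IsRelCompactDist (fun x y : t.Classes => (x.distance y : ℝ≥0∞)) A ↔
      ∀ r : ℝ≥0, IsRelCompactDist (MetFunctor.Classes.ghf (F := τ.pointed))
        (PosMetFunctor.Truncation.ballClasses A r) :=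
  ⟨PosMetFunctor.Truncation.isRelCompactDist_ballClasses hsub hsubBall hclosed,
    PosMetFunctor.Truncation.isRelCompactDist_of_ballClasses hrigid hcont hsub hsubBall hclosed⟩
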